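/- Consider a generalised Jackson network with $K$ single-server stations. Let $\xi_k$ and $\eta_k$ ($k=1,\dots,K$) denote generic exogenous interarrival and service times at station $k$: nonnegative random variables with $\mathbf P(\xi_k=0)=\mathbf P(\eta_k=0)=0$, with $\mathbf E e^{\theta\xi_k}<\infty$ and $\mathbf E e^{\theta\eta_k}<\infty$ for some $\theta>0$, and whose cumulative distribution functions are right-differentiable at $0$ with positive derivatives. Let $P=(p_{kl})$ be a row-substochastic $K\times K$ routing matrix of spectral radius less than one, let $\lambda_k=1/\mathbf E\xi_k$, $\mu_k=1/\mathbf E\eta_k$, and assume that the network is subcritical: $\mu>(I-P^T)^{-1}\lambda$ entrywise. Let $\beta_k=\sup\{\theta\ge0:\mathbf E e^{\theta\xi_k}<\infty\}$, $\gamma_k=\sup\{\theta\ge0:\mathbf E e^{\theta\eta_k}<\infty\}$, $\pi(u)=u\ln u-u+1$ for $u>0$, $\pi(0)=1$. For $\alpha,\delta\in\mathbb R_+^K$ and a row-substochastic matrix $\varrho$ with rows $\varrho_k$ put $$\psi^A_k(\alpha_k)=\sup_{\theta<\beta_k}\bigl(\theta-\alpha_k\ln\mathbf E e^{\theta\xi_k}\bigr),\qquad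 \psi^S_k(\delta_k)=\sup_{\theta<\gamma_k}\bigl(\theta-\delta_k\ln\mathbf E e^{\theta\eta_k}\bigr),$$ $$\psi^R_k(\varrho_k)=\sum_{l=1}^K\pi\Bigl(\frac{\varrho_{kl}}{p_{kl}}\Bigr)p_{kl}+\pi\Bigl(\frac{1-\sum_l\varrho_{kl}}{1-\sum_lp_{kl}}\Bigr)\Bigl(1-\sum_lp_{kl}\Bigr),$$ where a term $\pi(r/p)\,p$ with $p=0$ is $0$ if $r=0$ and, if $r>0$, is given one fixed value $c$, which may be either $0$ or $+\infty$ (the assertion holds for both choices). With the convention $0\cdot\infty=0$, for $J\subset\{1,\dots,K\}$ and $y\in\mathbb R^K$ let $$\Psi_J(y)=\inf\Bigl\{\sum_k\psi^A_k(\alpha_k)+\sum_{k\notin J}\psi^S_k(\delta_k)+\sum_{k\in J}\psi^S_k(\delta_k)1_{\{\delta_k>\mu_k\}}+\sum_k\delta_k\psi^R_k(\varrho_k)\Bigr\},$$ the infimum being over all $(\alpha,\delta,\varrho)$ as above with $y=\alpha+(\varrho^T-I)\delta$. Let $L(x,y)=\Psi_J(y)$ if $x\in\mathbb R_+^K$ and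 $J=\{k:x_k=0\}$. For a right-continuous path $q:\mathbb R_+\to\mathbb R_+^K$ with left limits let $\mathbf I_x(q)=\int_0^\infty L(q(t),\dot q(t))\,dt$ if $q$ is absolutely continuous with $q(0)=x$, and $\mathbf I_x(q)=\infty$ otherwise. For $x,y\in\mathbb R_+^K$ and $t\ge0$ let $$\mathbf\Pi_{x,t}(y)=\sup_{q:\,q(t)=y}e^{-\mathbf I_x(q)},\qquad \mathbf V(y)=\inf_{t\ge0}\ \inf_{q:\,q(t)=y}\mathbf I_0(q).$$ A deviability on a metric space $\Upsilon$ is a function $\mathbf\Pi$ from the subsets of $\Upsilon$ to $[0,1]$ with $\mathbf\Pi(\Gamma)=\sup_{\upsilon\in\Gamma}\mathbf\Pi(\{\upsilon\})$ for all $\Gamma\subset\Upsilon$, $\mathbf\Pi(\Upsilon)=1$, and $\{\upsilon:\mathbf\Pi(\{\upsilon\})\ge\kappa\}$ compact for every $\kappa\in(0,1]$; write $\mathbf\Pi(\upsilon)=\mathbf\Pi(\{\upsilon\})$. **Theorem.** There is a deviability $\hat{\mathbf\Pi}$ on $\mathbb R_+^K$ such that, for every bounded set $B\subset\mathbb R_+^K$,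 $$\lim_{t\to\infty}\ \sup_{x\in B}\ \sup_{y\in\mathbb R_+^K}\bigl|\mathbf\Pi_{x,t}(y)-\hat{\mathbf\Pi}(y)\bigr|=0 .$$ Furthermore, for every bounded $B$ and every $y\in\mathbb R_+^K$ one has $\mathbf\Pi_{x,t}(y)=\hat{\mathbf\Pi}(y)$ for all sufficiently large $t$ and all $x\in B$. The deviability $\hat{\mathbf\Pi}$ is the unique stationary deviability of the semigroup $\mathbf\Pi_{x,t}$, i.e. the unique deviability satisfying $$\hat{\mathbf\Pi}(y)=\sup_{x\in\mathbb R_+^K}\mathbf\Pi_{x,t}(y)\,\hat{\mathbf\Pi}(x)\qquad\text{for all }y\in\mathbb R_+^K,\ t\in\mathbb R_+ .$$ Moreover, $\hat{\mathbf\Pi}(y)=e^{-\mathbf V(y)}$ for all $y\in\mathbb R_+^K$. -/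

import Mathlib

open Set Filter Topology MeasureTheory
open scoped NNReal ENNReal Matrix

/-! ### Idempotent probabilities and deviabilities -/

/-- A set function `D` on all subsets of `Υ` is an idempotent probability if its value on a set is
the supremum of its values at the points of the set, and its total mass is `1`
(so that all of its values lie in `[0,1]`). -/
structure IsIdempotentProbability {Υ : Type*} (D : Set Υ → ℝ≥0∞) : Prop where
  eq_iSup : ∀ G : Set Υ, D G = ⨆ v ∈ G, D {v}
  univ_eq_one : D Set.univ = 1

/-- A deviability: an idempotent probability on a metric space with compact upper level sets. -/
structure IsDeviability {Υ : Type*} [MetricSpace Υ] (D : Set Υ → ℝ≥0∞) : Prop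
    extends IsIdempotentProbability D where
  isCompact_level : ∀ κ : ℝ≥0∞, 0 < κ → κ ≤ 1 → IsCompact {v : Υ | κ ≤ D {v}}

/-! ### The network -/

/-- The set of row-substochastic `K × K` matrices. -/
def substochastic (K : ℕ) : Set (Matrix (Fin K) (Fin K) ℝ) :=
  {ρ | (∀ k l, 0 ≤ ρ k l) ∧ ∀ k, ∑ l, ρ k l ≤ 1}

/-- The primitives of a generalised Jackson network with `K` stations: the laws of the generic
exogenous interarrival times `ξ_k`, the laws of the generic service times `η_k`, and the routing
matrix `P`. -/
structure JacksonNetwork (K : ℕ) where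
  arrivalLaw : Fin K → Measure ℝ
  serviceLaw : Fin K → Measure ℝ
  routing : Matrix (Fin K) (Fin K) ℝ

/-- Law of a positive random time having some finite exponential moment, and whose cumulative
distribution function is right-differentiable at `0` with a positive derivative. -/
structure IsGenericTimeLaw (ν : Measure ℝ) : Prop where
  isProbabilityMeasure : IsProbabilityMeasure ν
  positive : ν (Iic 0) = 0
  exp_moment : ∃ θ : ℝ, 0 < θ ∧ Integrable (fun u => Real.exp (θ * u)) ν
  cdf_deriv : ∃ c : ℝ, 0 < c ∧ HasDerivWithinAt (fun u : ℝ => ν.real (Iic u)) c (Ici 0) 0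

namespace JacksonNetwork

variable {K : ℕ}

/-- The standing assumptions on the primitives: generic times as above, and a substochastic routing
matrix whose (complex) spectral radius is less than one. -/
structure IsAdmissible (N : JacksonNetwork K) : Prop where
  arrival : ∀ k, IsGenericTimeLaw (N.arrivalLaw k)
  service : ∀ k, IsGenericTimeLaw (N.serviceLaw k)
  routing_mem : N.routing ∈ substochastic K
  routing_radius : spectralRadius ℂ (N.routing.map ((↑) : ℝ → ℂ)) < 1

/-- `λ_k = 1 / E ξ_k`. -/
noncomputable def arrivalRate (N : JacksonNetwork K) (k : Fin K) : ℝ :=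
  (∫ u, u ∂(N.arrivalLaw k))⁻¹

/-- `μ_k = 1 / E η_k`. -/
noncomputable def serviceRate (N : JacksonNetwork K) (k : Fin K) : ℝ :=
  (∫ u, u ∂(N.serviceLaw k))⁻¹

/-- The network is subcritical: `μ > (I - Pᵀ)⁻¹ λ`, entrywise. -/
def IsSubcritical (N : JacksonNetwork K) : Prop :=
  ∀ k, ((1 - N.routingᵀ)⁻¹ *ᵥ N.arrivalRate) k < N.serviceRate k

end JacksonNetwork

/-! ### The local rate function -/

/-- The abscissa `sup {θ ≥ 0 : E exp (θ X) < ∞}`, for `X` with law `ν`; it may be infinite. -/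
noncomputable def expAbscissa (ν : Measure ℝ) : EReal :=
  sSup ((fun θ : ℝ => (θ : EReal)) ''
    {θ : ℝ | 0 ≤ θ ∧ Integrable (fun u => Real.exp (θ * u)) ν})

/-- `sup_{θ < β} (θ - a ln E exp (θ X))`, for `X` with law `ν` and abscissa `β`. For a generic
time law `β > 0`, and the term with `θ = 0` is zero, so truncating the negative terms at zero
does not change the supremum. -/
noncomputable def renewalRate (ν : Measure ℝ) (a : ℝ) : ℝ≥0∞ :=
  ⨆ (θ : ℝ) (_ : (θ : EReal) < expAbscissa ν),
    ENNReal.ofReal (θ - a * Real.log (∫ u, Real.exp (θ * u) ∂ν))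

/-- The term `π(r / p) p`, where `π(u) = u ln u - u + 1`, `π(0) = 1`. If `p = 0` it is zero for
`r = 0`, and for `r > 0` it has the form `∞ · 0` and is given the value `c`. -/
noncomputable def entropyTerm (c : ℝ≥0∞) (r p : ℝ) : ℝ≥0∞ :=
  if p = 0 then (if r = 0 then 0 else c)
  else ENNReal.ofReal (((r / p) * Real.log (r / p) - r / p + 1) * p)

/-- `ψ^R_k`, for the row `p` of the routing matrix, as a function of the row `r`. -/
noncomputable def routingRate (c : ℝ≥0∞) {K : ℕ} (p r : Fin K → ℝ) : ℝ≥0∞ :=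
  ∑ l, entropyTerm c (r l) (p l) + entropyTerm c (1 - ∑ l, r l) (1 - ∑ l, p l)

namespace JacksonNetwork

variable {K : ℕ}

/-- `ψ_J(α, δ, ϱ)`. -/
noncomputable def psi (N : JacksonNetwork K) (c : ℝ≥0∞) (J : Finset (Fin K))
    (α δ : Fin K → ℝ) (ρ : Matrix (Fin K) (Fin K) ℝ) : ℝ≥0∞ :=
  ∑ k, renewalRate (N.arrivalLaw k) (α k)
    + ∑ k ∈ Jᶜ, renewalRate (N.serviceLaw k) (δ k)
    + ∑ k ∈ J, {d : ℝ | N.serviceRate k < d}.indicator (renewalRate (N.serviceLaw k)) (δ k)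
    + ∑ k, ENNReal.ofReal (δ k) * routingRate c (N.routing k) (ρ k)

/-- `Ψ_J(y)`: the infimum of `ψ_J(α, δ, ϱ)` subject to `y = α + (ϱᵀ - I) δ`. -/
noncomputable def Psi (N : JacksonNetwork K) (c : ℝ≥0∞) (J : Finset (Fin K))
    (y : Fin K → ℝ) : ℝ≥0∞ :=
  ⨅ (α : Fin K → ℝ) (δ : Fin K → ℝ) (ρ : Matrix (Fin K) (Fin K) ℝ)
    (_ : (∀ k, 0 ≤ α k) ∧ (∀ k, 0 ≤ δ k) ∧ ρ ∈ substochastic K ∧ y = α + (ρᵀ - 1) *ᵥ δ),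
    N.psi c J α δ ρ

end JacksonNetwork

/-- The state space `ℝ₊^K`. -/
abbrev Orthant (K : ℕ) : Type := Fin K → ℝ≥0

/-- The face `F_J` of `ℝ₊^K`; for `J = ∅` it is the interior of the orthant. -/
def face {K : ℕ} (J : Finset (Fin K)) : Set (Orthant K) :=
  {x | (∀ k ∈ J, x k = 0) ∧ ∀ k ∉ J, 0 < x k}

/-- Right-continuous with left-hand limits. -/
def IsCadlag {E : Type*} [TopologicalSpace E] (q : ℝ≥0 → E) : Prop :=
  ∀ t, ContinuousWithinAt q (Ici t) t ∧ ∃ l, Tendsto q (𝓝[<] t) (𝓝 l)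

/-- The space `𝔻(ℝ₊, ℝ₊^K)` of right-continuous paths with left-hand limits. -/
def PathSpace (K : ℕ) : Type := {q : ℝ≥0 → Orthant K // IsCadlag q}

namespace PathSpace

variable {K : ℕ}

/-- The `k`-th coordinate of a path, as a real function of real time (only `t ≥ 0` matters). -/
def coord (q : PathSpace K) (k : Fin K) (t : ℝ) : ℝ := (q.1 t.toNNReal k : ℝ)

/-- Absolute continuity of a path (on every bounded time interval). -/
def IsAbsCont (q : PathSpace K) : Prop :=
  ∀ (k : Fin K) (T : ℝ), 0 ≤ T → AbsolutelyContinuousOnInterval (q.coord k) 0 T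

/-- The velocity `q̇(t)`, which exists for almost all `t` when `q` is absolutely continuous. -/
noncomputable def velocity (q : PathSpace K) (t : ℝ) : Fin K → ℝ :=
  fun k => deriv (q.coord k) t

end PathSpace

/-! ### The action functional, the idempotent semigroup and the quasipotential -/

namespace JacksonNetwork

variable {K : ℕ}

/-- `L(x, y) = ∑_J 1_{F_J}(x) Ψ_J(y)`. -/
noncomputable def lagrangian (N : JacksonNetwork K) (c : ℝ≥0∞) (x : Orthant K)
    (y : Fin K → ℝ) : ℝ≥0∞ :=
  ∑ J : Finset (Fin K), (face J).indicator (fun _ => N.Psi c J y) x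

open Classical in
/-- `I_x(q) = ∫₀^∞ L(q(t), q̇(t)) dt` if `q` is absolutely continuous with `q(0) = x`, and
`I_x(q) = ∞` otherwise. -/
noncomputable def action (N : JacksonNetwork K) (c : ℝ≥0∞) (x : Orthant K)
    (q : PathSpace K) : ℝ≥0∞ :=
  if q.IsAbsCont ∧ q.1 0 = x then
    ∫⁻ t in Ioi (0 : ℝ), N.lagrangian c (q.1 t.toNNReal) (q.velocity t)
  else ⊤

/-- `Π_{x,t}(Γ) = sup_{y ∈ Γ} sup_{q : q(t) = y} exp (-I_x(q))`. -/
noncomputable def transition (N : JacksonNetwork K) (c : ℝ≥0∞) (x : Orthant K) (t : ℝ≥0)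
    (G : Set (Orthant K)) : ℝ≥0∞ :=
  ⨆ y ∈ G, ⨆ (q : PathSpace K) (_ : q.1 t = y), EReal.exp (-(N.action c x q : EReal))

/-- `D` is stationary for the semigroup `Π_{x,t}`:
`D(y) = sup_x Π_{x,t}(y) D(x)` for all `y` and `t`. -/
def IsStationary (N : JacksonNetwork K) (c : ℝ≥0∞) (D : Set (Orthant K) → ℝ≥0∞) : Prop :=
  ∀ (y : Orthant K) (t : ℝ≥0), D {y} = ⨆ x : Orthant K, N.transition c x t {y} * D {x}

/-- The quasipotential `V(x) = inf_t inf_{q : q(t) = x} I_0(q)`. -/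
noncomputable def quasipotential (N : JacksonNetwork K) (c : ℝ≥0∞) (x : Orthant K) : ℝ≥0∞ :=
  ⨅ (t : ℝ≥0) (q : PathSpace K) (_ : q.1 t = x), N.action c 0 q

end JacksonNetwork

/-! The proof rests on two facts about the network near and away from the origin. First, weight each
customer by `v = (I - P)⁻¹ 1`, the expected number of services still due to it. Off the origin, the
weighted content decreases at a rate `b > 0`, up to `C` times the cost rate
(`IsAdmissible.exists_lyapunov`). Hence a path of cost `a` avoiding the origin lasts at most
`(content + C a) / b`, and a path started at the origin cannot reach content above `C a`. Second,
the origin is a free rest point and every state drains to it free of charge along a piecewise linear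
fluid path (`IsAdmissible.exists_reach_zero`).

Together they show that for large `t` the starting point is forgotten. A cheap path from `x` to `y`
must visit the origin, and its part after the last visit already costs at least `V(y)`. Conversely,
a nearly optimal path from the origin to `y` may be cut at its last visit to the origin, so that its
duration is bounded; draining `x` first and then resting at the origin fills the remaining time at
no cost. So the least action equals `V(y)` where `V(y) < M`, and both are at least `M` elsewhere,
from a time depending only on `M` and a bound on the content of `x`. This is `min_quasipotential_le`
and `leastAction_le_quasipotential`; exponentiating gives both forms of convergence.

Compactness of the level sets of `exp(-V)` follows from the content bound and from the Lipschitz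
continuity of `V`, which holds because slow straight motion has bounded cost everywhere.
Stationarity is dynamic programming for `V`. Uniqueness follows because the level sets of any
stationary deviability are bounded, so the convergence is uniform on them. -/

/-! ### Nonnegative matrices of spectral radius less than one -/

section MaximumPrinciple

attribute [local instance] Matrix.linftyOpNormedRing Matrix.linftyOpNormedAlgebra
  Matrix.linftyOpNormedAddCommGroup Matrix.linftyOpNormedSpace

/-- In a Banach algebra, the powers of an element of spectral radius less than one tend to zero. -/
theorem tendsto_pow_of_spectralRadius_lt_one {A : Type*} [NormedRing A] [NormedAlgebra ℂ A]
    [CompleteSpace A] (a : A) (ha : spectralRadius ℂ a < 1) :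
    Tendsto (fun n : ℕ => a ^ n) atTop (𝓝 0) := by
  obtain ⟨r, hr1, hr2⟩ := ENNReal.lt_iff_exists_nnreal_btwn.1 ha
  have hr2' : r < 1 := by exact_mod_cast hr2
  have h := (spectrum.pow_nnnorm_pow_one_div_tendsto_nhds_spectralRadius a).eventually
    (gt_mem_nhds hr1)
  rw [tendsto_zero_iff_norm_tendsto_zero]
  refine squeeze_zero' (Eventually.of_forall fun _ => norm_nonneg _) ?_
    (tendsto_pow_atTop_nhds_zero_of_lt_one r.2 (by exact_mod_cast hr2' : (r : ℝ) < 1))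
  filter_upwards [h, eventually_gt_atTop 0] with n hn hn0
  have hn0' : (0 : ℝ) < n := by exact_mod_cast hn0
  have h1 : ((‖a ^ n‖₊ : ℝ≥0∞) ^ (1 / (n : ℝ))) ^ (n : ℝ) ≤ (r : ℝ≥0∞) ^ (n : ℝ) :=
    ENNReal.rpow_le_rpow hn.le hn0'.le
  rw [← ENNReal.rpow_mul, one_div, inv_mul_cancel₀ hn0'.ne', ENNReal.rpow_one,
    ENNReal.rpow_natCast] at h1
  exact_mod_cast h1

/-- The local operator norm only serves to make complex matrices a Banach algebra; the limit is then
read off entrywise through real parts. -/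
theorem Matrix.tendsto_pow_apply_of_spectralRadius_lt_one {n : Type*} [Fintype n] [DecidableEq n]
    (A : Matrix n n ℝ) (hA : spectralRadius ℂ (A.map ((↑) : ℝ → ℂ)) < 1) (i j : n) :
    Tendsto (fun m : ℕ => (A ^ m) i j) atTop (𝓝 0) := by
  have h := tendsto_pow_of_spectralRadius_lt_one (A.map ((↑) : ℝ → ℂ)) hA
  have h2 : Continuous fun M : Matrix n n ℂ => (M i j).re :=
    Complex.continuous_re.comp ((continuous_apply j).comp (continuous_apply i))
  have h3 := (h2.tendsto 0).comp h
  have h4 : (fun m : ℕ => (A ^ m) i j) = (fun M : Matrix n n ℂ => (M i j).re) ∘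
      fun m : ℕ => (A.map ((↑) : ℝ → ℂ)) ^ m := by
    funext m
    have : (A.map ((↑) : ℝ → ℂ)) ^ m = (A ^ m).map ((↑) : ℝ → ℂ) := by
      have := map_pow (RingHom.mapMatrix (m := n) Complex.ofRealHom) A m
      exact this.symm
    simp [this]
  rw [h4]
  simpa using h3

end MaximumPrinciple

/-- The maximum principle: a vector each of whose coordinates is nonpositive or dominated
by the image of the vector is nonpositive. -/
def Matrix.HasMaxPrinciple {n : Type*} [Fintype n] (A : Matrix n n ℝ) : Prop :=
  ∀ u : n → ℝ, (∀ k, u k ≤ 0 ∨ u k ≤ (A *ᵥ u) k) → ∀ k, u k ≤ 0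

theorem Matrix.mulVec_mono_of_nonneg {n : Type*} [Fintype n] {A : Matrix n n ℝ}
    (hA : ∀ i j, 0 ≤ A i j) {u w : n → ℝ} (h : u ≤ w) : A *ᵥ u ≤ A *ᵥ w := fun i =>
  Finset.sum_le_sum fun j _ => mul_le_mul_of_nonneg_left (h j) (hA i j)

/-- The positive part `z` of `u` satisfies `z ≤ A z`, since `A` is nonnegative. Iterating gives `z ≤
A ^ m z`, which tends to zero. -/
theorem Matrix.hasMaxPrinciple_of_tendsto {n : Type*} [Fintype n] [DecidableEq n]
    {A : Matrix n n ℝ} (hA : ∀ i j, 0 ≤ A i j)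
    (h : ∀ i j, Tendsto (fun m : ℕ => (A ^ m) i j) atTop (𝓝 0)) : A.HasMaxPrinciple := by
  intro u hu k
  set z : n → ℝ := fun k => max (u k) 0
  have hz : z ≤ A *ᵥ z := by
    intro k
    have h0 : 0 ≤ (A *ᵥ z) k :=
      Finset.sum_nonneg fun j _ => mul_nonneg (hA k j) (le_max_right _ _)
    refine max_le ?_ h0
    rcases hu k with h1 | h1
    · exact h1.trans h0
    · exact h1.trans (mulVec_mono_of_nonneg hA (fun j => le_max_left _ _) k)
  have hzn : ∀ m : ℕ, z ≤ (A ^ m) *ᵥ z := by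
    intro m
    induction m with
    | zero => simp
    | succ m ih =>
      rw [pow_succ', ← Matrix.mulVec_mulVec]
      exact hz.trans (mulVec_mono_of_nonneg hA ih)
  have hlim : Tendsto (fun m : ℕ => ((A ^ m) *ᵥ z) k) atTop (𝓝 0) := by
    simp only [Matrix.mulVec, dotProduct]
    simpa using tendsto_finsetSum Finset.univ fun j _ => (h k j).mul_const (z j)
  exact (le_max_left _ _).trans (ge_of_tendsto' hlim fun m => hzn m k)

namespace Matrix.HasMaxPrinciple

variable {n : Type*} [Fintype n] [DecidableEq n] {A : Matrix n n ℝ}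

theorem isUnit_one_sub (h : A.HasMaxPrinciple) : IsUnit (1 - A) := by
  rw [← Matrix.mulVec_injective_iff_isUnit]
  have key : ∀ u : n → ℝ, (1 - A) *ᵥ u = 0 → u = 0 := by
    intro u hu
    rw [Matrix.sub_mulVec, Matrix.one_mulVec, sub_eq_zero] at hu
    refine funext fun k => le_antisymm (h u (fun k => Or.inr (congrFun hu k).le) k) ?_
    have := h (-u) (fun k => Or.inr (by rw [Matrix.mulVec_neg, ← hu])) k
    simpa using this
  intro u w huw
  refine sub_eq_zero.1 (key _ ?_)
  rw [Matrix.mulVec_sub, sub_eq_zero]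
  exact huw

theorem eq_add_mulVec_resolvent (h : A.HasMaxPrinciple) (f : n → ℝ) :
    (1 - A)⁻¹ *ᵥ f = f + A *ᵥ ((1 - A)⁻¹ *ᵥ f) := by
  have h1 : (1 - A) *ᵥ ((1 - A)⁻¹ *ᵥ f) = f := by
    rw [Matrix.mulVec_mulVec, Matrix.mul_nonsing_inv _ ((Matrix.isUnit_iff_isUnit_det _).1
      h.isUnit_one_sub), Matrix.one_mulVec]
  rw [Matrix.sub_mulVec, Matrix.one_mulVec, sub_eq_iff_eq_add] at h1
  exact h1

/-- Comparison: a vector satisfying `u ≤ f + A u` is dominated by the solution. -/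
theorem le_resolvent (h : A.HasMaxPrinciple) {f u : n → ℝ} (hu : u ≤ f + A *ᵥ u) :
    u ≤ (1 - A)⁻¹ *ᵥ f := by
  intro k
  have := h (u - (1 - A)⁻¹ *ᵥ f) (fun k => Or.inr ?_) k
  · simpa using this
  · have h1 := congrFun (h.eq_add_mulVec_resolvent f) k
    have h2 := hu k
    rw [Matrix.mulVec_sub]
    simp only [Pi.sub_apply, Pi.add_apply] at *
    linarith

theorem resolvent_nonneg (h : A.HasMaxPrinciple) {f : n → ℝ} (hf : 0 ≤ f) :
    0 ≤ (1 - A)⁻¹ *ᵥ f := by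
  refine h.le_resolvent ?_
  simpa using hf

theorem self_le_resolvent (h : A.HasMaxPrinciple) (hA : ∀ i j, 0 ≤ A i j) {f : n → ℝ}
    (hf : 0 ≤ f) : f ≤ (1 - A)⁻¹ *ᵥ f := by
  rw [h.eq_add_mulVec_resolvent f]
  refine le_add_of_nonneg_right ?_
  have := Matrix.mulVec_mono_of_nonneg hA (h.resolvent_nonneg hf)
  simpa using this

end Matrix.HasMaxPrinciple

namespace JacksonNetwork

variable {K : ℕ} {N : JacksonNetwork K}

theorem IsAdmissible.routing_nonneg (hN : N.IsAdmissible) (k l : Fin K) : 0 ≤ N.routing k l :=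
  hN.routing_mem.1 k l

theorem IsAdmissible.hasMaxPrinciple (hN : N.IsAdmissible) : N.routing.HasMaxPrinciple :=
  Matrix.hasMaxPrinciple_of_tendsto hN.routing_mem.1
    (Matrix.tendsto_pow_apply_of_spectralRadius_lt_one _ hN.routing_radius)

theorem IsAdmissible.hasMaxPrinciple_transpose (hN : N.IsAdmissible) :
    N.routingᵀ.HasMaxPrinciple := by
  refine Matrix.hasMaxPrinciple_of_tendsto (fun i j => hN.routing_mem.1 j i) fun i j => ?_
  simp only [← Matrix.transpose_pow, Matrix.transpose_apply]
  exact Matrix.tendsto_pow_apply_of_spectralRadius_lt_one _ hN.routing_radius j i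

end JacksonNetwork

/-! ### Costs of arrival and service rates -/

namespace IsGenericTimeLaw

variable {ν : Measure ℝ}

theorem ae_pos (h : IsGenericTimeLaw ν) : ∀ᵐ u ∂ν, 0 < u := by
  have := h.positive
  rw [ae_iff]
  simpa [Iic] using this

theorem integrable_exp_of_le (h : IsGenericTimeLaw ν) {θ θ' : ℝ} (hθ : θ ≤ θ')
    (hi : Integrable (fun u => Real.exp (θ' * u)) ν) :
    Integrable (fun u => Real.exp (θ * u)) ν := by
  refine hi.mono' (by fun_prop) ?_
  filter_upwards [h.ae_pos] with u hu
  rw [Real.norm_eq_abs, abs_of_pos (Real.exp_pos _)]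
  gcongr

theorem exists_lt_expAbscissa (h : IsGenericTimeLaw ν) :
    ∃ θ₀ : ℝ, 0 < θ₀ ∧ Integrable (fun u => Real.exp (θ₀ * u)) ν ∧
      ∀ θ < θ₀, (θ : EReal) < expAbscissa ν := by
  obtain ⟨θ₀, h0, hi⟩ := h.exp_moment
  refine ⟨θ₀, h0, hi, fun θ hθ => ?_⟩
  exact (EReal.coe_lt_coe_iff.2 hθ).trans_le (le_sSup ⟨θ₀, ⟨h0.le, hi⟩, rfl⟩)

theorem integrable_exp_of_lt (h : IsGenericTimeLaw ν) {θ : ℝ}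
    (hθ : (θ : EReal) < expAbscissa ν) : Integrable (fun u => Real.exp (θ * u)) ν := by
  obtain ⟨_, ⟨θ', ⟨_, hi⟩, rfl⟩, hlt⟩ := lt_sSup_iff.1 hθ
  exact h.integrable_exp_of_le (EReal.coe_lt_coe_iff.1 hlt).le hi

theorem zero_mem_interior (h : IsGenericTimeLaw ν) :
    (0 : ℝ) ∈ interior (ProbabilityTheory.integrableExpSet id ν) := by
  obtain ⟨θ₀, h0, hi, _⟩ := h.exists_lt_expAbscissa
  rw [mem_interior]
  exact ⟨Iio θ₀, fun θ hθ => h.integrable_exp_of_le (le_of_lt hθ) hi, isOpen_Iio, h0⟩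

theorem integrable_id (h : IsGenericTimeLaw ν) : Integrable (fun u : ℝ => u) ν :=
  ProbabilityTheory.integrable_of_mem_interior_integrableExpSet h.zero_mem_interior

theorem mean_pos (h : IsGenericTimeLaw ν) : 0 < ∫ u, u ∂ν := by
  have := h.isProbabilityMeasure
  rw [integral_pos_iff_support_of_nonneg_ae (h.ae_pos.mono fun u hu => hu.le) h.integrable_id]
  have : Function.support (fun u : ℝ => u) = {0}ᶜ := by ext; simp
  rw [this, prob_compl_eq_one_sub (measurableSet_singleton 0),
    measure_mono_null (by simp) h.positive]
  simp

/-- Jensen's inequality, by integrating the tangent line of the exponential at `θ` times the mean.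
-/
theorem exp_mean_le (h : IsGenericTimeLaw ν) {θ : ℝ}
    (hi : Integrable (fun u => Real.exp (θ * u)) ν) :
    Real.exp (θ * ∫ u, u ∂ν) ≤ ∫ u, Real.exp (θ * u) ∂ν := by
  have := h.isProbabilityMeasure
  set m := ∫ u, u ∂ν with hm
  have h1 : ∫ u, Real.exp (θ * m) * (1 + θ * (u - m)) ∂ν = Real.exp (θ * m) := by
    have h2 : Integrable (fun u => θ * (u - m)) ν :=
      (h.integrable_id.sub (integrable_const m)).const_mul θ
    rw [integral_const_mul, integral_add (integrable_const _) h2, integral_const_mul,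
      integral_sub h.integrable_id (integrable_const m)]
    simp [← hm]
  rw [← h1]
  refine integral_mono (((integrable_const _).add ((h.integrable_id.sub
    (integrable_const m)).const_mul θ)).const_mul _) hi fun u => ?_
  have h3 := Real.add_one_le_exp (θ * (u - m))
  calc Real.exp (θ * m) * (1 + θ * (u - m)) ≤ Real.exp (θ * m) * Real.exp (θ * (u - m)) := by
        gcongr; linarith
    _ = Real.exp (θ * u) := by rw [← Real.exp_add]; ring_nf

theorem mul_mean_le_log (h : IsGenericTimeLaw ν) {θ : ℝ}
    (hθ : (θ : EReal) < expAbscissa ν) :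
    θ * (∫ u, u ∂ν) ≤ Real.log (∫ u, Real.exp (θ * u) ∂ν) := by
  have h1 := h.exp_mean_le (h.integrable_exp_of_lt hθ)
  exact (Real.le_log_iff_exp_le ((Real.exp_pos _).trans_le h1)).2 h1

/-- The rate vanishes at the reciprocal of the mean. -/
theorem renewalRate_inv_mean (h : IsGenericTimeLaw ν) : renewalRate ν (∫ u, u ∂ν)⁻¹ = 0 := by
  refine le_antisymm (iSup₂_le fun θ hθ => ?_) zero_le
  rw [nonpos_iff_eq_zero, ENNReal.ofReal_eq_zero, sub_nonpos, inv_mul_eq_div,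
    le_div_iff₀ h.mean_pos]
  exact h.mul_mean_le_log hθ

/-- A positive right derivative at `0` forces mass arbitrarily near `0`. This is what makes
arbitrarily fast arrivals and services possible at finite cost. -/
theorem cdf_pos (h : IsGenericTimeLaw ν) {u : ℝ} (hu : 0 < u) : 0 < ν.real (Iic u) := by
  have := h.isProbabilityMeasure
  obtain ⟨c, hc, hd⟩ := h.cdf_deriv
  by_contra hcon
  have hz : ν.real (Iic u) = 0 := le_antisymm (not_lt.1 hcon) measureReal_nonneg
  have hz' : ∀ x ∈ Icc 0 u, ν.real (Iic x) = 0 := fun x hx =>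
    le_antisymm ((measureReal_mono (Iic_subset_Iic.2 hx.2)).trans hz.le) measureReal_nonneg
  have h1 : HasDerivWithinAt (fun u : ℝ => ν.real (Iic u)) 0 (Icc 0 u) 0 :=
    (hasDerivWithinAt_const 0 _ (0 : ℝ)).congr hz' (hz' 0 ⟨le_rfl, hu.le⟩)
  have h2 := hd.mono (Icc_subset_Ici_self : Icc 0 u ⊆ Ici 0)
  exact hc.ne' ((uniqueDiffOn_Icc hu 0 ⟨le_rfl, hu.le⟩).eq_deriv _ h2 h1)

/-- The rate is bounded on bounded intervals to the right of the reciprocal of the mean. -/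
theorem renewalRate_le (h : IsGenericTimeLaw ν) (A : ℝ) :
    ∃ C : ℝ, 0 ≤ C ∧ ∀ a, (∫ u, u ∂ν)⁻¹ ≤ a → a ≤ A → renewalRate ν a ≤ ENNReal.ofReal C := by
  have := h.isProbabilityMeasure
  have hm := h.mean_pos
  by_cases hA : A ≤ 0
  · refine ⟨0, le_rfl, fun a ha ha' => ?_⟩
    exact absurd ((inv_pos.2 hm).trans_le (ha.trans ha')) hA.not_gt
  push Not at hA
  set F := ν.real (Iic A⁻¹) with hF
  have hFpos : 0 < F := h.cdf_pos (inv_pos.2 hA)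
  have hF1 : F ≤ 1 := measureReal_le_one
  have hlogF : Real.log F ≤ 0 := Real.log_nonpos hFpos.le hF1
  -- For `θ ≥ 0` Jensen makes the expression nonpositive. For `θ < 0` the exponential moment is at
  -- least its part on `(-∞, A⁻¹]`, hence at least `exp (θ / A) F`; since `a ≤ A`, only `-a log F`
  -- survives.
  refine ⟨-(A * Real.log F), by nlinarith, fun a ha haA => iSup₂_le fun θ hθ => ?_⟩
  have ha0 : 0 < a := (inv_pos.2 hm).trans_le ha
  have hi := h.integrable_exp_of_lt hθ
  refine ENNReal.ofReal_le_ofReal ?_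
  rcases le_or_gt 0 θ with h0 | h0
  · have h1 := h.mul_mean_le_log hθ
    have h2 : 1 ≤ a * ∫ u, u ∂ν := by rwa [inv_le_iff_one_le_mul₀ hm] at ha
    nlinarith
  · have h1 : Real.exp (θ * A⁻¹) * F ≤ ∫ u, Real.exp (θ * u) ∂ν := by
      calc Real.exp (θ * A⁻¹) * F = ∫ u in Iic A⁻¹, Real.exp (θ * A⁻¹) ∂ν := by
            simp [hF, mul_comm]
        _ ≤ ∫ u in Iic A⁻¹, Real.exp (θ * u) ∂ν := by
            refine setIntegral_mono_on (by simp) hi.integrableOn measurableSet_Iic fun u hu => ?_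
            exact Real.exp_le_exp.2 (mul_le_mul_of_nonpos_left hu h0.le)
        _ ≤ ∫ u, Real.exp (θ * u) ∂ν :=
            setIntegral_le_integral hi (Eventually.of_forall fun u => (Real.exp_pos _).le)
    have h2 : θ * A⁻¹ + Real.log F ≤ Real.log (∫ u, Real.exp (θ * u) ∂ν) := by
      rw [← Real.log_exp (θ * A⁻¹), ← Real.log_mul (Real.exp_pos _).ne' hFpos.ne']
      exact Real.log_le_log (by positivity) h1
    have h3 : a * (θ * A⁻¹) ≥ θ := by
      have : a * A⁻¹ ≤ 1 := by rw [← div_eq_mul_inv]; exact (div_le_one hA).2 haA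
      nlinarith
    nlinarith [mul_le_mul_of_nonneg_left h2 ha0.le]

/-- The cumulant generating function has derivative at `0` equal to the mean. It supplies the test
exponents `θ` near `0` in the two linear growth bounds. -/
theorem tendsto_log_div (h : IsGenericTimeLaw ν) :
    Tendsto (fun θ : ℝ => Real.log (∫ u, Real.exp (θ * u) ∂ν) / θ) (𝓝[≠] 0)
      (𝓝 (∫ u, u ∂ν)) := by
  have := h.isProbabilityMeasure
  have h1 := (ProbabilityTheory.analyticAt_cgf h.zero_mem_interior).differentiableAt.hasDerivAt
  rw [ProbabilityTheory.deriv_cgf_zero h.zero_mem_interior, hasDerivAt_iff_tendsto_slope] at h1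
  simp only [probReal_univ, div_one] at h1
  refine h1.congr fun θ => ?_
  rw [slope_def_field, ProbabilityTheory.cgf_zero, sub_zero, sub_zero]
  rfl

theorem le_of_renewalRate_le {a ℓ θ : ℝ} (hℓ : 0 ≤ ℓ)
    (ha : renewalRate ν a ≤ ENNReal.ofReal ℓ) (hθ : (θ : EReal) < expAbscissa ν) :
    θ - a * Real.log (∫ u, Real.exp (θ * u) ∂ν) ≤ ℓ :=
  (ENNReal.ofReal_le_ofReal_iff hℓ).1
    ((le_iSup₂ (f := fun (θ : ℝ) (_ : (θ : EReal) < expAbscissa ν) =>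
      ENNReal.ofReal (θ - a * Real.log (∫ u, Real.exp (θ * u) ∂ν))) θ hθ).trans ha)

/-- Linear growth of the rate to the right of the reciprocal of the mean. -/
theorem exists_le_of_renewalRate_le (h : IsGenericTimeLaw ν) {η : ℝ} (hη : 0 < η) :
    ∃ M : ℝ, 0 ≤ M ∧ ∀ a ℓ : ℝ, 0 ≤ a → 0 ≤ ℓ → renewalRate ν a ≤ ENNReal.ofReal ℓ →
      a - (∫ u, u ∂ν)⁻¹ ≤ η + M * ℓ := by
  set m := ∫ u, u ∂ν
  have hm : 0 < m := h.mean_pos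
  obtain ⟨θ₀, hθ₀, _, hlt⟩ := h.exists_lt_expAbscissa
  -- The supremum defining the rate is tested at a single small `θ < 0` whose log-moment quotient
  -- exceeds `(m⁻¹ + η)⁻¹`; the resulting inequality is affine in `a`.
  have hκ : (m⁻¹ + η)⁻¹ < m := inv_lt_of_inv_lt₀ hm (by linarith)
  have h1 := (h.tendsto_log_div.mono_left (nhdsWithin_mono 0
    (show Iio (0 : ℝ) ⊆ {0}ᶜ from fun x hx => ne_of_lt hx))).eventually (lt_mem_nhds hκ)
  obtain ⟨θ, h2, h3⟩ := (h1.and self_mem_nhdsWithin).exists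
  have h3 : θ < 0 := h3
  have hp : 0 < m⁻¹ + η := by positivity
  refine ⟨(m⁻¹ + η) / (-θ), div_nonneg hp.le (by linarith), fun a ℓ ha hℓ hr => ?_⟩
  have h4 := le_of_renewalRate_le hℓ hr (hlt θ (h3.trans hθ₀))
  rw [lt_div_iff_of_neg h3] at h2
  have h5 : a * ((m⁻¹ + η)⁻¹ * (-θ)) ≤ ℓ - θ := by nlinarith
  have h6 : a * (-θ) ≤ (ℓ - θ) * (m⁻¹ + η) := by
    have := mul_le_mul_of_nonneg_right h5 hp.le
    calc a * (-θ) = a * ((m⁻¹ + η)⁻¹ * (-θ)) * (m⁻¹ + η) := by field_simp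
      _ ≤ _ := this
  have h7 : a ≤ (ℓ - θ) * (m⁻¹ + η) / (-θ) := (le_div_iff₀ (by linarith)).2 h6
  have h8 : (ℓ - θ) * (m⁻¹ + η) / (-θ) = m⁻¹ + η + (m⁻¹ + η) / (-θ) * ℓ := by
    have : θ ≠ 0 := h3.ne
    field_simp
    ring
  linarith

/-- Linear growth of the rate to the left of the reciprocal of the mean. -/
theorem exists_ge_of_renewalRate_le (h : IsGenericTimeLaw ν) {η : ℝ} (hη : 0 < η) :
    ∃ M : ℝ, 0 ≤ M ∧ ∀ a ℓ : ℝ, 0 ≤ a → 0 ≤ ℓ → renewalRate ν a ≤ ENNReal.ofReal ℓ →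
      (∫ u, u ∂ν)⁻¹ - a ≤ η + M * ℓ := by
  set m := ∫ u, u ∂ν
  have hm : 0 < m := h.mean_pos
  obtain ⟨θ₀, hθ₀, _, hlt⟩ := h.exists_lt_expAbscissa
  -- Here a small `θ > 0` is tested. The value `κ` is just above the mean and satisfies `κ⁻¹ ≥ m⁻¹ -
  -- η`.
  set κ := m * (1 + η * m)
  have hκ : m < κ := by
    have : 0 < m * (η * m) := by positivity
    simp only [κ]; nlinarith
  have h1 := (h.tendsto_log_div.mono_left (nhdsWithin_mono 0
    (show Ioi (0 : ℝ) ⊆ {0}ᶜ from fun x hx => ne_of_gt hx))).eventually (gt_mem_nhds hκ)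
  obtain ⟨θ, ⟨h2, h3⟩, h3'⟩ := ((h1.and self_mem_nhdsWithin).and
    (mem_nhdsWithin_of_mem_nhds (gt_mem_nhds hθ₀))).exists
  have h3 : 0 < θ := h3
  have hκ0 : 0 < κ := hm.trans hκ
  refine ⟨1 / (θ * κ), by positivity, fun a ℓ ha hℓ hr => ?_⟩
  have h4 := le_of_renewalRate_le hℓ hr (hlt θ h3')
  rw [div_lt_iff₀ h3] at h2
  have h5 : θ ≤ ℓ + a * (κ * θ) := by nlinarith
  have h6 : κ⁻¹ ≤ a + 1 / (θ * κ) * ℓ := by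
    have : κ⁻¹ = θ / (θ * κ) := by field_simp
    rw [this, div_le_iff₀ (by positivity)]
    have : (a + 1 / (θ * κ) * ℓ) * (θ * κ) = ℓ + a * (κ * θ) := by field_simp; ring
    linarith
  have h7 : m⁻¹ - η ≤ κ⁻¹ := by
    have : κ⁻¹ = m⁻¹ * (1 + η * m)⁻¹ := by simp [κ, mul_comm]
    rw [this]
    have h8 : 1 - η * m ≤ (1 + η * m)⁻¹ := by
      rw [← one_div, le_div_iff₀ (by positivity)]
      nlinarith [sq_nonneg (η * m)]
    calc m⁻¹ - η = m⁻¹ * (1 - η * m) := by field_simp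
      _ ≤ _ := by gcongr
  linarith

/-- Linear growth of the truncated rate at an empty station. -/
theorem exists_le_of_indicator_renewalRate_le (h : IsGenericTimeLaw ν) {η : ℝ} (hη : 0 < η) :
    ∃ M : ℝ, 0 ≤ M ∧ ∀ a ℓ : ℝ, 0 ≤ a → 0 ≤ ℓ →
      {d : ℝ | (∫ u, u ∂ν)⁻¹ < d}.indicator (renewalRate ν) a ≤ ENNReal.ofReal ℓ →
      a - (∫ u, u ∂ν)⁻¹ ≤ η + M * ℓ := by
  obtain ⟨M, hM, hM'⟩ := h.exists_le_of_renewalRate_le hη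
  refine ⟨M, hM, fun a ℓ ha hℓ hr => ?_⟩
  by_cases hlt : (∫ u, u ∂ν)⁻¹ < a
  · rw [indicator_of_mem (by exact hlt)] at hr
    exact hM' a ℓ ha hℓ hr
  · have := mul_nonneg hM hℓ
    linarith

end IsGenericTimeLaw

/-! ### Costs of routing -/

section Routing

variable {K : ℕ}

theorem entropyTerm_self (c : ℝ≥0∞) (p : ℝ) : entropyTerm c p p = 0 := by
  unfold entropyTerm
  split_ifs with h
  · rfl
  · simp [div_self h]

theorem routingRate_self (c : ℝ≥0∞) (p : Fin K → ℝ) : routingRate c p p = 0 := by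
  simp [routingRate, entropyTerm_self]

/-- The entropy dominates its tangent `-s u - (exp (-s) - 1)` of slope `-s`, and a small `s` brings
the constant below `η`. Only the deficit `p - r` is bounded, which is trivial at `p = 0`, so `M`
does not depend on `c`. -/
theorem exists_sub_le_of_entropyTerm_le {p : ℝ} (hp : 0 ≤ p) {η : ℝ} (hη : 0 < η) :
    ∃ M : ℝ, 0 ≤ M ∧ ∀ (c : ℝ≥0∞) (r ℓ : ℝ), 0 ≤ r → 0 ≤ ℓ →
      entropyTerm c r p ≤ ENNReal.ofReal ℓ → p - r ≤ η + M * ℓ := by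
  rcases hp.eq_or_lt with rfl | hp0
  · refine ⟨0, le_rfl, fun c r ℓ hr hℓ _ => ?_⟩
    linarith
  have hlim : Tendsto (fun s : ℝ => p * (1 - (1 - Real.exp (-s)) / s)) (𝓝[≠] 0) (𝓝 0) := by
    have h1 : HasDerivAt (fun s : ℝ => 1 - Real.exp (-s)) 1 0 := by
      have := ((hasDerivAt_id (0 : ℝ)).neg.exp).const_sub 1
      simpa using this
    rw [hasDerivAt_iff_tendsto_slope] at h1
    have h2 := (h1.const_sub 1).const_mul p
    simp only [sub_self, mul_zero] at h2
    refine h2.congr fun s => ?_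
    simp [slope_def_field]
  obtain ⟨s, h1, h2⟩ := (((hlim.mono_left (nhdsWithin_mono 0
    (show Ioi (0 : ℝ) ⊆ {0}ᶜ from fun x hx => ne_of_gt hx))).eventually (gt_mem_nhds hη)).and self_mem_nhdsWithin).exists
  have h2 : 0 < s := h2
  refine ⟨1 / s, by positivity, fun c r ℓ hr hℓ hle => ?_⟩
  rw [entropyTerm, if_neg hp0.ne', ENNReal.ofReal_le_ofReal_iff hℓ] at hle
  set u := r / p with hu
  have hru : r = u * p := by rw [hu]; field_simp
  have hu0 : 0 ≤ u := by positivity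
  -- the Legendre inequality for the entropy at slope `-s`
  have hleg : -s * u - (Real.exp (-s) - 1) ≤ u * Real.log u - u + 1 := by
    rcases hu0.eq_or_lt with h0 | h0
    · rw [← h0]
      have := Real.exp_pos (-s)
      simp
      linarith
    · have h3 := Real.add_one_le_exp (-s - Real.log u)
      rw [Real.exp_sub, Real.exp_log h0, le_div_iff₀ h0] at h3
      nlinarith
  have h4 : (-s * u - (Real.exp (-s) - 1)) * p ≤ ℓ :=
    (mul_le_mul_of_nonneg_right hleg hp0.le).trans hle
  have h5 : p - r = p * (1 - (1 - Real.exp (-s)) / s) +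
      1 / s * ((-s * u - (Real.exp (-s) - 1)) * p) := by
    rw [hru]; field_simp; ring
  have h6 : 1 / s * ((-s * u - (Real.exp (-s) - 1)) * p) ≤ 1 / s * ℓ := by gcongr
  linarith

/-- Linear growth of the routing cost. -/
theorem exists_sub_le_of_routingRate_le {p : Fin K → ℝ} (hp : ∀ l, 0 ≤ p l)
    (hp1 : ∑ l, p l ≤ 1) {η : ℝ} (hη : 0 < η) :
    ∃ M : ℝ, 0 ≤ M ∧ ∀ (c : ℝ≥0∞) (d : ℝ) (r : Fin K → ℝ) (ℓ : ℝ), (∀ l, 0 ≤ r l) →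
      ∑ l, r l ≤ 1 → 0 ≤ d → 0 ≤ ℓ → ENNReal.ofReal d * routingRate c p r ≤ ENNReal.ofReal ℓ →
      ∀ l, d * (r l - p l) ≤ η * d + M * ℓ := by
  set η' := η / (K + 1)
  have hη' : 0 < η' := by positivity
  have h1 := fun l => exists_sub_le_of_entropyTerm_le (hp l) hη'
  choose M hM hM' using h1
  obtain ⟨M₀, hM₀, hM₀'⟩ := exists_sub_le_of_entropyTerm_le (sub_nonneg.2 hp1) hη'
  refine ⟨∑ l, M l + M₀, add_nonneg (Finset.sum_nonneg fun l _ => hM l) hM₀, ?_⟩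
  intro c d r ℓ hr hr1 hd hℓ hle l
  rcases hd.eq_or_lt with rfl | hd0
  · have : 0 ≤ (∑ l, M l + M₀) * ℓ :=
      mul_nonneg (add_nonneg (Finset.sum_nonneg fun l _ => hM l) hM₀) hℓ
    simpa using this
  have hle' : routingRate c p r ≤ ENNReal.ofReal (ℓ / d) := by
    rw [ENNReal.ofReal_div_of_pos hd0, ENNReal.le_div_iff_mul_le (by simp [hd0]) (by simp)]
    rwa [mul_comm]
  have hℓd : 0 ≤ ℓ / d := by positivity
  have h2 : ∀ k, p k - r k ≤ η' + M k * (ℓ / d) := fun k => by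
    refine hM' k c (r k) _ (hr k) hℓd (le_trans ?_ hle')
    exact (Finset.single_le_sum (f := fun l => entropyTerm c (r l) (p l))
      (fun _ _ => zero_le) (Finset.mem_univ k)).trans le_self_add
  have h3 := hM₀' c _ (ℓ / d) (sub_nonneg.2 hr1) hℓd (le_trans le_add_self hle')
  -- All outcomes, leaving included, have total probability one. An excess at `l` is therefore the
  -- sum of the deficits of the other outcomes, and these are the quantities already bounded.
  have h4 : r l - p l = (∑ k ∈ Finset.univ.erase l, (p k - r k)) +
      ((1 - ∑ k, p k) - (1 - ∑ k, r k)) := by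
    have e1 := Finset.sum_erase_add Finset.univ p (Finset.mem_univ l)
    have e2 := Finset.sum_erase_add Finset.univ r (Finset.mem_univ l)
    rw [Finset.sum_sub_distrib]
    linarith
  have h5 : ∑ k ∈ Finset.univ.erase l, (p k - r k) ≤ K * η' + (∑ k, M k) * (ℓ / d) := by
    calc ∑ k ∈ Finset.univ.erase l, (p k - r k)
        ≤ ∑ k ∈ Finset.univ.erase l, (η' + M k * (ℓ / d)) :=
          Finset.sum_le_sum fun k _ => h2 k
      _ ≤ ∑ k, (η' + M k * (ℓ / d)) :=
          Finset.sum_le_sum_of_subset_of_nonneg (Finset.erase_subset _ _)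
            fun k _ _ => by have := mul_nonneg (hM k) hℓd; positivity
      _ = K * η' + (∑ k, M k) * (ℓ / d) := by
          rw [Finset.sum_add_distrib, Finset.sum_mul]; simp
  have h6 : (K + 1) * η' = η := by simp only [η']; field_simp
  have h7 : r l - p l ≤ η + (∑ k, M k + M₀) * (ℓ / d) := by
    rw [← h6, h4]; linarith
  calc d * (r l - p l) ≤ d * (η + (∑ k, M k + M₀) * (ℓ / d)) := by gcongr
    _ = η * d + (∑ k, M k + M₀) * ℓ := by field_simp

end Routing

/-! ### The local rate function and the Lyapunov inequality -/

theorem exists_pos_le_of_forall_pos {ι : Type*} [Finite ι] (f : ι → ℝ) (hf : ∀ i, 0 < f i) :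
    ∃ m : ℝ, 0 < m ∧ ∀ i, m ≤ f i := by
  cases isEmpty_or_nonempty ι
  · exact ⟨1, one_pos, fun i => isEmptyElim i⟩
  · obtain ⟨i, hi⟩ := Finite.exists_min f
    exact ⟨f i, hf i, hi⟩

namespace JacksonNetwork

variable {K : ℕ} {N : JacksonNetwork K} {c : ℝ≥0∞}

/-- The traffic intensities `(I - Pᵀ)⁻¹ λ`. -/
noncomputable def throughput (N : JacksonNetwork K) : Fin K → ℝ :=
  (1 - N.routingᵀ)⁻¹ *ᵥ N.arrivalRate

theorem IsAdmissible.arrivalRate_pos (hN : N.IsAdmissible) (k : Fin K) : 0 < N.arrivalRate k :=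
  inv_pos.2 (hN.arrival k).mean_pos

theorem IsAdmissible.serviceRate_pos (hN : N.IsAdmissible) (k : Fin K) : 0 < N.serviceRate k :=
  inv_pos.2 (hN.service k).mean_pos

theorem IsAdmissible.throughput_eq (hN : N.IsAdmissible) :
    N.throughput = N.arrivalRate + N.routingᵀ *ᵥ N.throughput :=
  hN.hasMaxPrinciple_transpose.eq_add_mulVec_resolvent _

theorem IsAdmissible.routing_transpose_nonneg (hN : N.IsAdmissible) (k l : Fin K) :
    0 ≤ N.routingᵀ k l := hN.routing_nonneg l k

theorem IsAdmissible.throughput_pos (hN : N.IsAdmissible) (k : Fin K) : 0 < N.throughput k :=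
  (hN.arrivalRate_pos k).trans_le (hN.hasMaxPrinciple_transpose.self_le_resolvent
    hN.routing_transpose_nonneg (fun k => (hN.arrivalRate_pos k).le) k)

theorem lagrangian_eq (N : JacksonNetwork K) (c : ℝ≥0∞) (x : Orthant K) (y : Fin K → ℝ) :
    N.lagrangian c x y = N.Psi c (Finset.univ.filter fun k => x k = 0) y := by
  unfold lagrangian
  rw [Finset.sum_eq_single (Finset.univ.filter fun k => x k = 0)]
  · have hx : x ∈ face (Finset.univ.filter fun k => x k = 0) :=
      ⟨fun k hk => by simpa using hk, fun k hk => pos_iff_ne_zero.2 (by simpa using hk)⟩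
    exact indicator_of_mem hx _
  · intro J _ hJ
    refine indicator_of_notMem (fun hx => hJ ?_) _
    ext k
    simp only [Finset.mem_filter, Finset.mem_univ, true_and]
    exact ⟨fun hk => hx.1 k hk, fun hk => by_contra fun hk' => (hx.2 k hk').ne' hk⟩
  · simp

theorem Psi_le_psi {J : Finset (Fin K)} {y α δ : Fin K → ℝ} {ρ : Matrix (Fin K) (Fin K) ℝ}
    (hα : ∀ k, 0 ≤ α k) (hδ : ∀ k, 0 ≤ δ k) (hρ : ρ ∈ substochastic K)
    (hy : y = α + (ρᵀ - 1) *ᵥ δ) : N.Psi c J y ≤ N.psi c J α δ ρ :=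
  iInf₂_le_of_le α δ (iInf₂_le ρ ⟨hα, hδ, hρ, hy⟩)

/-- The fluid velocities have zero cost. -/
theorem IsAdmissible.lagrangian_fluid (hN : N.IsAdmissible) (x : Orthant K) {δ : Fin K → ℝ}
    (hδ : ∀ k, 0 ≤ δ k) (hδμ : ∀ k, δ k ≤ N.serviceRate k)
    (hδx : ∀ k, x k ≠ 0 → δ k = N.serviceRate k) :
    N.lagrangian c x (N.arrivalRate + (N.routingᵀ - 1) *ᵥ δ) = 0 := by
  rw [lagrangian_eq]
  refine le_antisymm ((Psi_le_psi (fun k => (hN.arrivalRate_pos k).le) hδ hN.routing_mem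
    rfl).trans ?_) zero_le
  have h1 : ∀ k, renewalRate (N.arrivalLaw k) (N.arrivalRate k) = 0 :=
    fun k => (hN.arrival k).renewalRate_inv_mean
  have h2 : ∀ k ∈ (Finset.univ.filter fun k => x k = 0)ᶜ,
      renewalRate (N.serviceLaw k) (δ k) = 0 := fun k hk => by
    rw [hδx k (by simpa using hk)]
    exact (hN.service k).renewalRate_inv_mean
  have h3 : ∀ k ∈ Finset.univ.filter fun k => x k = 0,
      {d : ℝ | N.serviceRate k < d}.indicator (renewalRate (N.serviceLaw k)) (δ k) = 0 :=
    fun k _ => indicator_of_notMem (fun h => (hδμ k).not_gt h) _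
  unfold psi
  rw [Finset.sum_eq_zero h2, Finset.sum_eq_zero h3]
  simp [h1, routingRate_self]

/-- Moderate velocities have bounded cost everywhere. -/
theorem IsAdmissible.exists_lagrangian_le (hN : N.IsAdmissible) :
    ∃ C : ℝ, 0 < C ∧ ∀ (c : ℝ≥0∞) (x : Orthant K) (w : Fin K → ℝ), (∀ k, |w k| ≤ 1) →
      N.lagrangian c x w ≤ ENNReal.ofReal C := by
  -- Scaling the solution of the traffic equations by `s` leaves the net drift zero. With `s` this
  -- large, `α = s λ + w` stays above `λ` and `δ = s` times the throughput stays above `μ`, the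
  -- range where the rates are bounded.
  set s := 1 + ∑ k, (1 / N.arrivalRate k) + ∑ k, N.serviceRate k / N.throughput k with hs
  have hl := hN.arrivalRate_pos
  have hm := hN.serviceRate_pos
  have hn := hN.throughput_pos
  have hs1 : ∀ k, 1 + 1 / N.arrivalRate k ≤ s := fun k => by
    have := Finset.single_le_sum (f := fun k => 1 / N.arrivalRate k)
      (fun k _ => (one_div_pos.2 (hl k)).le) (Finset.mem_univ k)
    have h2 : 0 ≤ ∑ k, N.serviceRate k / N.throughput k :=
      Finset.sum_nonneg fun k _ => (div_pos (hm k) (hn k)).le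
    linarith
  have hs2 : ∀ k, N.serviceRate k / N.throughput k ≤ s := fun k => by
    have := Finset.single_le_sum (f := fun k => N.serviceRate k / N.throughput k)
      (fun k _ => (div_pos (hm k) (hn k)).le) (Finset.mem_univ k)
    have h2 : 0 ≤ ∑ k, 1 / N.arrivalRate k :=
      Finset.sum_nonneg fun k _ => (one_div_pos.2 (hl k)).le
    linarith
  have hs1' : ∀ k, N.arrivalRate k + 1 ≤ s * N.arrivalRate k := fun k => by
    have := mul_le_mul_of_nonneg_right (hs1 k) (hl k).le
    rwa [add_mul, one_mul, one_div, inv_mul_cancel₀ (hl k).ne'] at this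
  have hs2' : ∀ k, N.serviceRate k ≤ s * N.throughput k := fun k =>
    (div_le_iff₀ (hn k)).1 (hs2 k)
  choose C hC hCa using fun k => (hN.arrival k).renewalRate_le (s * N.arrivalRate k + 1)
  choose C' hC' hCs using fun k => (hN.service k).renewalRate_le (s * N.throughput k)
  refine ⟨∑ k, C k + ∑ k, C' k + ∑ k, C' k + 1, ?_, fun c x w hw => ?_⟩
  · have h1 := Finset.sum_nonneg fun k (_ : k ∈ Finset.univ) => hC k
    have h2 := Finset.sum_nonneg fun k (_ : k ∈ Finset.univ) => hC' k
    linarith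
  rw [lagrangian_eq]
  set α : Fin K → ℝ := fun k => s * N.arrivalRate k + w k
  set δ : Fin K → ℝ := fun k => s * N.throughput k
  have hα : ∀ k, N.arrivalRate k ≤ α k := fun k => by
    have := (abs_le.1 (hw k)).1
    have := hs1' k
    simp only [α]; linarith
  have hα' : ∀ k, α k ≤ s * N.arrivalRate k + 1 := fun k => by
    have := (abs_le.1 (hw k)).2
    simp only [α]; linarith
  refine (Psi_le_psi (α := α) (δ := δ) (fun k => (hl k).le.trans (hα k))
    (fun k => (hm k).le.trans (hs2' k)) hN.routing_mem ?_).trans ?_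
  · have h1 : δ = s • N.throughput := rfl
    funext k
    have h2 := congrFun hN.throughput_eq k
    rw [h1, Matrix.mulVec_smul, Matrix.sub_mulVec, Matrix.one_mulVec]
    simp only [Pi.add_apply, Pi.smul_apply, Pi.sub_apply, smul_eq_mul, α] at *
    rw [h2]
    ring
  · have h1 : ∑ k, renewalRate (N.arrivalLaw k) (α k) ≤ ENNReal.ofReal (∑ k, C k) := by
      rw [ENNReal.ofReal_sum_of_nonneg fun k _ => hC k]
      exact Finset.sum_le_sum fun k _ => hCa k _ (hα k) (hα' k)
    have h2 : ∀ J : Finset (Fin K), ∑ k ∈ J, renewalRate (N.serviceLaw k) (δ k) ≤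
        ENNReal.ofReal (∑ k, C' k) := fun J => by
      rw [ENNReal.ofReal_sum_of_nonneg fun k _ => hC' k]
      exact (Finset.sum_le_sum_of_subset (Finset.subset_univ J)).trans
        (Finset.sum_le_sum fun k _ => hCs k _ (hs2' k) le_rfl)
    have h3 : ∀ J : Finset (Fin K),
        ∑ k ∈ J, {d : ℝ | N.serviceRate k < d}.indicator (renewalRate (N.serviceLaw k)) (δ k) ≤
        ENNReal.ofReal (∑ k, C' k) := fun J =>
      (Finset.sum_le_sum fun k _ =>
        indicator_le_self _ (renewalRate (N.serviceLaw k)) (δ k)).trans (h2 J)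
    have h4 : (0 : ℝ) ≤ ∑ k, C k := Finset.sum_nonneg fun k _ => hC k
    have h5 : (0 : ℝ) ≤ ∑ k, C' k := Finset.sum_nonneg fun k _ => hC' k
    unfold psi
    simp only [routingRate_self, mul_zero, Finset.sum_const_zero, add_zero]
    refine (add_le_add (add_le_add h1 (h2 _)) (h3 _)).trans ?_
    rw [← ENNReal.ofReal_add h4 h5, ← ENNReal.ofReal_add (by positivity) h5]
    exact ENNReal.ofReal_le_ofReal (by linarith)

/-- The workload drift: if the input exceeds the mean by at most `e` and the service deficit at
busy stations is at most `d`, then the total workload decreases at rate at least `m`, up to a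
linear error. -/
theorem IsAdmissible.sum_workload_le (hN : N.IsAdmissible) {m e d : ℝ} (hm : 0 ≤ m)
    (hmμ : ∀ k, m ≤ N.serviceRate k - N.throughput k) (he : 0 ≤ e) (hd : 0 ≤ d)
    {S : Set (Fin K)} (hS : S.Nonempty) {u δ : Fin K → ℝ}
    (hin : u + δ ≤ N.arrivalRate + (fun _ => e) + N.routingᵀ *ᵥ (u + δ))
    (hdef : ∀ k ∈ S, N.serviceRate k - δ k ≤ d)
    (hJ : ∀ k ∉ S, u k = (N.routingᵀ *ᵥ u) k) :
    ∑ k, u k + m ≤ (d + e * ∑ k, ((1 - N.routingᵀ)⁻¹ *ᵥ fun _ => (1 : ℝ)) k) *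
      ∑ k, ((1 - N.routingᵀ)⁻¹ *ᵥ fun _ => (1 : ℝ)) k := by
  have hP := hN.hasMaxPrinciple_transpose
  set w := (1 - N.routingᵀ)⁻¹ *ᵥ fun _ => (1 : ℝ) with hw
  have hw1 : ∀ k, 1 ≤ w k :=
    hP.self_le_resolvent hN.routing_transpose_nonneg (f := fun _ => 1) (fun _ => zero_le_one)
  have hweq : ∀ k, w k = 1 + (N.routingᵀ *ᵥ w) k := fun k =>
    congrFun (hP.eq_add_mulVec_resolvent fun _ => (1 : ℝ)) k
  have hwW : ∀ k, w k ≤ ∑ k, w k := fun k =>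
    Finset.single_le_sum (fun k _ => zero_le_one.trans (hw1 k)) (Finset.mem_univ k)
  set W := ∑ k, w k
  obtain ⟨k₀, hk₀⟩ := hS
  have hW1 : 1 ≤ W := (hw1 k₀).trans (hwW k₀)
  set E := d + e * W with hE
  have hE0 : 0 ≤ E := by positivity
  -- Resolving the perturbed traffic inequality bounds `u + δ`. At stations of `S` the lower bound
  -- on `δ` then gives `u ≤ E - m`.
  have hsum : ∀ k, u k + δ k ≤ N.throughput k + e * w k := fun k => by
    have h1 := hP.le_resolvent hin k
    have h2 : (N.arrivalRate + fun _ => e) = N.arrivalRate + e • fun _ : Fin K => (1 : ℝ) := by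
      funext k; simp
    rw [h2, Matrix.mulVec_add, Matrix.mulVec_smul] at h1
    exact h1
  have hS : ∀ k ∈ S, u k ≤ E - m := fun k hk => by
    have h1 := hsum k
    have h2 := hdef k hk
    have h3 := hmμ k
    have h4 := mul_le_mul_of_nonneg_left (hwW k) he
    simp only [hE]
    linarith
  -- If `E ≤ m`, the maximum principle gives `u ≤ 0` everywhere and the single station `k₀` supplies
  -- the drift. Otherwise `u` is compared with the supersolution `(E - m) w`. Both cases use `1 ≤
  -- W`.
  rcases le_total E m with hEm | hEm
  · have h1 : ∀ k, u k ≤ 0 := hP u fun k => by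
      by_cases hk : k ∈ S
      · exact Or.inl ((hS k hk).trans (by linarith))
      · exact Or.inr (hJ k hk).le
    have h2 : ∑ k, u k ≤ u k₀ := by
      rw [← Finset.sum_erase_add _ _ (Finset.mem_univ k₀)]
      have := Finset.sum_nonpos fun k (_ : k ∈ Finset.univ.erase k₀) => h1 k
      linarith
    have h3 := hS k₀ hk₀
    nlinarith
  · have h1 : ∀ k, (u - (E - m) • w) k ≤ 0 := hP _ fun k => by
      rw [Matrix.mulVec_sub, Matrix.mulVec_smul]
      simp only [Pi.sub_apply, Pi.smul_apply, smul_eq_mul]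
      by_cases hk : k ∈ S
      · left
        have h1 := hS k hk
        have h2 := hw1 k
        nlinarith
      · right
        rw [hJ k hk, hweq k]
        nlinarith
    have h2 : ∑ k, u k ≤ (E - m) * W := by
      rw [Finset.mul_sum]
      refine Finset.sum_le_sum fun k _ => ?_
      have := h1 k
      simp only [Pi.sub_apply, Pi.smul_apply, smul_eq_mul] at this
      linarith
    nlinarith

/-- The two resolvents are adjoint. This turns the drift of the linear function `v` into the sum of
the workload velocities `u`, to which the maximum principle applies. -/
theorem IsAdmissible.dotProduct_eq_sum_workload (hN : N.IsAdmissible) (y : Fin K → ℝ) :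
    ((1 - N.routing)⁻¹ *ᵥ fun _ => (1 : ℝ)) ⬝ᵥ y = ∑ k, ((1 - N.routingᵀ)⁻¹ *ᵥ y) k := by
  have hveq := hN.hasMaxPrinciple.eq_add_mulVec_resolvent fun _ => (1 : ℝ)
  have hueq := hN.hasMaxPrinciple_transpose.eq_add_mulVec_resolvent y
  generalize (1 - N.routing)⁻¹ *ᵥ (fun _ => (1 : ℝ)) = v at *
  generalize (1 - N.routingᵀ)⁻¹ *ᵥ y = u at *
  have h1 : v ⬝ᵥ u = v ⬝ᵥ y + v ⬝ᵥ (N.routingᵀ *ᵥ u) := by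
    rw [← dotProduct_add, ← hueq]
  have h2 : v ⬝ᵥ u = ∑ k, u k + (N.routing *ᵥ v) ⬝ᵥ u := by
    conv_lhs => rw [hveq, add_dotProduct]
    simp [dotProduct]
  have h3 : v ⬝ᵥ (N.routingᵀ *ᵥ u) = (N.routing *ᵥ v) ⬝ᵥ u := by
    rw [Matrix.dotProduct_mulVec, Matrix.vecMul_transpose]
  linarith

/-- All deviations from the mean behaviour are controlled linearly by the cost. -/
theorem IsAdmissible.exists_deviation_le (hN : N.IsAdmissible) {η : ℝ} (hη0 : 0 < η) :
    ∃ M : ℝ, 0 ≤ M ∧ ∀ (c : ℝ≥0∞) (J : Finset (Fin K)) (α δ : Fin K → ℝ)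
      (ρ : Matrix (Fin K) (Fin K) ℝ) (ℓ : ℝ), (∀ k, 0 ≤ α k) → (∀ k, 0 ≤ δ k) →
      ρ ∈ substochastic K → 0 ≤ ℓ → N.psi c J α δ ρ = ENNReal.ofReal ℓ →
      (∀ k, α k - N.arrivalRate k ≤ η + M * ℓ) ∧
      (∀ k ∉ J, N.serviceRate k - δ k ≤ η + M * ℓ) ∧
      (∀ k, δ k ≤ N.serviceRate k + 1 + M * ℓ) ∧
      (∀ k l, δ k * (ρ k l - N.routing k l) ≤ η * δ k + M * ℓ) := by
  choose M₁ hM₁ hA using fun k => (hN.arrival k).exists_le_of_renewalRate_le hη0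
  choose M₂ hM₂ hD using fun k => (hN.service k).exists_ge_of_renewalRate_le hη0
  -- Slack `1` suffices here, since this bound only keeps `δ` from being large. Being stated for the
  -- truncated rate, it covers empty and busy stations alike.
  choose M₃ hM₃ hB using fun k => (hN.service k).exists_le_of_indicator_renewalRate_le one_pos
  choose M₄ hM₄ hR using fun k => exists_sub_le_of_routingRate_le (hN.routing_mem.1 k)
    (hN.routing_mem.2 k) hη0
  have hM : ∀ k, 0 ≤ M₁ k + M₂ k + M₃ k + M₄ k := fun k =>
    add_nonneg (add_nonneg (add_nonneg (hM₁ k) (hM₂ k)) (hM₃ k)) (hM₄ k)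
  refine ⟨∑ k, (M₁ k + M₂ k + M₃ k + M₄ k), Finset.sum_nonneg fun k _ => hM k,
    fun c J α δ ρ ℓ hα hδ hρ hℓ0 hψ => ?_⟩
  have hle : ∀ k, M₁ k + M₂ k + M₃ k + M₄ k ≤ ∑ k, (M₁ k + M₂ k + M₃ k + M₄ k) := fun k =>
    Finset.single_le_sum (f := fun k => M₁ k + M₂ k + M₃ k + M₄ k) (fun k _ => hM k)
      (Finset.mem_univ k)
  generalize ∑ k, (M₁ k + M₂ k + M₃ k + M₄ k) = M at hle
  have hmul : ∀ k (m : ℝ), m ≤ M₁ k + M₂ k + M₃ k + M₄ k → m * ℓ ≤ M * ℓ := fun k m hm =>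
    mul_le_mul_of_nonneg_right (hm.trans (hle k)) hℓ0
  have tD : ∀ k ∉ J, renewalRate (N.serviceLaw k) (δ k) ≤ ENNReal.ofReal ℓ := fun k hk => by
    rw [← hψ]
    unfold psi
    exact (Finset.single_le_sum (f := fun k => renewalRate (N.serviceLaw k) (δ k))
      (fun _ _ => zero_le) (Finset.mem_compl.2 hk)).trans
      (le_add_self.trans (le_self_add.trans le_self_add))
  refine ⟨fun k => ?_, fun k hk => ?_, fun k => ?_, fun k l => ?_⟩
  · have t : renewalRate (N.arrivalLaw k) (α k) ≤ ENNReal.ofReal ℓ := by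
      rw [← hψ]
      unfold psi
      exact (Finset.single_le_sum (f := fun k => renewalRate (N.arrivalLaw k) (α k))
        (fun _ _ => zero_le) (Finset.mem_univ k)).trans
        (le_self_add.trans (le_self_add.trans le_self_add))
    have h1 : α k - N.arrivalRate k ≤ η + M₁ k * ℓ := hA k _ ℓ (hα k) hℓ0 t
    have h2 := hmul k (M₁ k) (by linarith [hM₂ k, hM₃ k, hM₄ k])
    linarith
  · have h1 : N.serviceRate k - δ k ≤ η + M₂ k * ℓ := hD k _ ℓ (hδ k) hℓ0 (tD k hk)
    have h2 := hmul k (M₂ k) (by linarith [hM₁ k, hM₃ k, hM₄ k])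
    linarith
  · have t : {d : ℝ | N.serviceRate k < d}.indicator (renewalRate (N.serviceLaw k)) (δ k) ≤
        ENNReal.ofReal ℓ := by
      by_cases hk : k ∈ J
      · rw [← hψ]
        unfold psi
        exact (Finset.single_le_sum (f := fun k => {d : ℝ | N.serviceRate k < d}.indicator
          (renewalRate (N.serviceLaw k)) (δ k)) (fun _ _ => zero_le) hk).trans
          (le_add_self.trans le_self_add)
      · exact (indicator_le_self _ (renewalRate (N.serviceLaw k)) (δ k)).trans (tD k hk)
    have h1 : δ k - N.serviceRate k ≤ 1 + M₃ k * ℓ := hB k _ ℓ (hδ k) hℓ0 t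
    have h2 := hmul k (M₃ k) (by linarith [hM₁ k, hM₂ k, hM₄ k])
    linarith
  · have t : ENNReal.ofReal (δ k) * routingRate c (N.routing k) (ρ k) ≤ ENNReal.ofReal ℓ := by
      rw [← hψ]
      unfold psi
      exact (Finset.single_le_sum (f := fun k => ENNReal.ofReal (δ k) *
        routingRate c (N.routing k) (ρ k)) (fun _ _ => zero_le) (Finset.mem_univ k)).trans
        le_add_self
    have h1 := hR k c (δ k) (ρ k) ℓ (hρ.1 k) (hρ.2 k) (hδ k) hℓ0 t l
    have h2 := hmul k (M₄ k) (by linarith [hM₁ k, hM₂ k, hM₃ k])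
    linarith

/-- The Lyapunov inequality: off the origin, the workload decreases at a positive rate, unless
there is a cost. -/
theorem IsAdmissible.exists_lyapunov (hN : N.IsAdmissible) (hsub : N.IsSubcritical) :
    ∃ (v : Fin K → ℝ) (b C : ℝ), (∀ k, 1 ≤ v k) ∧ 0 < b ∧ 0 < C ∧
      ∀ (c : ℝ≥0∞) (x : Orthant K) (y : Fin K → ℝ), x ≠ 0 → (∀ k, x k = 0 → y k = 0) →
        ENNReal.ofReal (v ⬝ᵥ y + b) ≤ ENNReal.ofReal C * N.lagrangian c x y := by
  have hP := hN.hasMaxPrinciple_transpose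
  have hv1 : ∀ k, 1 ≤ ((1 - N.routing)⁻¹ *ᵥ fun _ => (1 : ℝ)) k :=
    hN.hasMaxPrinciple.self_le_resolvent hN.routing_nonneg (f := fun _ => 1)
      (fun _ => zero_le_one)
  have hvy := hN.dotProduct_eq_sum_workload
  generalize (1 - N.routing)⁻¹ *ᵥ (fun _ => (1 : ℝ)) = v at *
  obtain ⟨m, hm, hmμ⟩ := exists_pos_le_of_forall_pos
    (fun k => N.serviceRate k - N.throughput k) (fun k => sub_pos.2 (hsub k))
  have hwork := fun (e d : ℝ) he hd (S : Set (Fin K)) hS u δ =>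
    hN.sum_workload_le (e := e) (d := d) hm.le hmμ he hd (S := S) hS (u := u) (δ := δ)
  have hW0 : 0 ≤ ∑ k, ((1 - N.routingᵀ)⁻¹ *ᵥ fun _ => (1 : ℝ)) k := Finset.sum_nonneg fun k _ =>
    hP.resolvent_nonneg (f := fun _ => 1) (fun _ => zero_le_one) k
  generalize ∑ k, ((1 - N.routingᵀ)⁻¹ *ᵥ fun _ => (1 : ℝ)) k = W at hwork hW0
  have hU : 0 ≤ ∑ k, N.serviceRate k := Finset.sum_nonneg fun k _ => (hN.serviceRate_pos k).le
  obtain ⟨U, hUeq⟩ : ∃ U, U = ∑ k, N.serviceRate k := ⟨_, rfl⟩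
  rw [← hUeq] at hU
  -- `Q` collects the factor of `η` in the final error, so `η = m / (2 Q)` spends at most half of
  -- the drift `m`. The added `1` keeps `Q` positive.
  obtain ⟨Q, hQ⟩ : ∃ Q, Q = W * (1 + W * (1 + U + K)) + 1 := ⟨_, rfl⟩
  have hQ0 : 0 < Q := by rw [hQ]; positivity
  obtain ⟨η, hη⟩ : ∃ η, η = m / (2 * Q) := ⟨_, rfl⟩
  have hη0 : 0 < η := by rw [hη]; positivity
  obtain ⟨M, hM, hdev⟩ := hN.exists_deviation_le hη0
  obtain ⟨C, hC⟩ : ∃ C, C = W * (M + W * (M + η * (K * M) + K * M)) := ⟨_, rfl⟩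
  have hC0 : 0 ≤ C := by rw [hC]; positivity
  have hC1 : 0 < C + 1 := by positivity
  refine ⟨v, m / 2, C + 1, hv1, by positivity, hC1, fun c x y hx hy => ?_⟩
  have hC1' : ENNReal.ofReal (C + 1) ≠ 0 := by simpa using hC1
  rw [mul_comm, ← ENNReal.div_le_iff_le_mul (Or.inl hC1') (Or.inl ENNReal.ofReal_ne_top),
    lagrangian_eq]
  refine le_iInf fun α => le_iInf fun δ => le_iInf fun ρ => le_iInf fun ⟨hα, hδ, hρ, hyeq⟩ => ?_
  obtain ⟨J, hJ⟩ : ∃ J : Finset (Fin K), J = Finset.univ.filter fun k => x k = 0 := ⟨_, rfl⟩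
  have hJx : ∀ k, k ∈ J ↔ x k = 0 := fun k => by simp [hJ]
  rw [← hJ, ENNReal.div_le_iff_le_mul (Or.inl hC1') (Or.inl ENNReal.ofReal_ne_top)]
  by_cases htop : N.psi c J α δ ρ = ⊤
  · rw [htop, ENNReal.top_mul hC1']
    exact le_top
  have hψ : N.psi c J α δ ρ = ENNReal.ofReal (N.psi c J α δ ρ).toReal :=
    (ENNReal.ofReal_toReal htop).symm
  have hℓ0 : 0 ≤ (N.psi c J α δ ρ).toReal := ENNReal.toReal_nonneg
  rw [hψ]
  generalize (N.psi c J α δ ρ).toReal = ℓ at *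
  obtain ⟨bA, bD, bB, bR⟩ := hdev c J α δ ρ ℓ hα hδ hρ hℓ0 hψ
  have bδ : ∑ k, δ k ≤ U + K + K * M * ℓ := by
    calc ∑ k, δ k ≤ ∑ k, (N.serviceRate k + 1 + M * ℓ) := Finset.sum_le_sum fun k _ => bB k
      _ = _ := by
          simp only [Finset.sum_add_distrib, Finset.sum_const, Finset.card_univ,
            Fintype.card_fin, nsmul_eq_mul, mul_one, hUeq, mul_assoc]
  have hueq := hP.eq_add_mulVec_resolvent y
  have hvy := hvy y
  generalize (1 - N.routingᵀ)⁻¹ *ᵥ y = u at hueq hvy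
  obtain ⟨e, he⟩ : ∃ e, e = η * (1 + U + K) + (M + η * (K * M) + K * M) * ℓ := ⟨_, rfl⟩
  have he0 : 0 ≤ e := by rw [he]; positivity
  have hd0 : 0 ≤ η + M * ℓ := by positivity
  -- With `u = y + Pᵀ u`, the balance `y = α + (ϱᵀ - I) δ` becomes the traffic equation for `u + δ`,
  -- except that `α` replaces `λ` and `ϱ` replaces `P`; `e` bounds both discrepancies.
  have hin : u + δ ≤ N.arrivalRate + (fun _ => e) + N.routingᵀ *ᵥ (u + δ) := by
    intro l
    have h1 := congrFun hueq l
    have h2 := congrFun hyeq l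
    have h3 : ∑ k, δ k * (ρ k l - N.routing k l) ≤
        η * (U + K + K * M * ℓ) + K * M * ℓ := by
      calc ∑ k, δ k * (ρ k l - N.routing k l) ≤ ∑ k, (η * δ k + M * ℓ) :=
            Finset.sum_le_sum fun k _ => bR k l
        _ = η * ∑ k, δ k + K * M * ℓ := by
            rw [Finset.sum_add_distrib, Finset.mul_sum]
            simp [mul_assoc]
        _ ≤ _ := by gcongr
    have h4 : ∑ k, δ k * (ρ k l - N.routing k l) = (ρᵀ *ᵥ δ) l - (N.routingᵀ *ᵥ δ) l := by
      simp only [Matrix.mulVec, dotProduct, Matrix.transpose_apply, ← Finset.sum_sub_distrib]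
      exact Finset.sum_congr rfl fun k _ => by ring
    have h5 := bA l
    rw [Matrix.sub_mulVec, Matrix.one_mulVec] at h2
    rw [Matrix.mulVec_add]
    simp only [Pi.add_apply, Pi.sub_apply] at *
    rw [he]
    linarith
  have hne : ({k | k ∉ J} : Set (Fin K)).Nonempty := by
    by_contra hcon
    refine hx (funext fun k => ?_)
    by_contra hk
    exact hcon ⟨k, fun h => hk ((hJx k).1 h)⟩
  -- This uses that the velocity vanishes at empty stations: there `u` is harmonic for `Pᵀ`, and no
  -- lower bound on the service rate is needed.
  have hzero : ∀ k ∉ ({k | k ∉ J} : Set (Fin K)), u k = (N.routingᵀ *ᵥ u) k := fun k hk => by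
    have h1 := congrFun hueq k
    rw [Pi.add_apply, hy k ((hJx k).1 (not_not.1 hk)), zero_add] at h1
    exact h1
  have hmain := hwork e (η + M * ℓ) he0 hd0 _ hne u δ hin (fun k hk => bD k hk) hzero
  have h1 : (η + M * ℓ + e * W) * W = η * Q - η + C * ℓ := by
    rw [he, hQ, hC]
    ring
  have h2 : η * Q = m / 2 := by rw [hη]; field_simp
  rw [← ENNReal.ofReal_mul hℓ0]
  refine ENNReal.ofReal_le_ofReal ?_
  rw [hvy]
  linarith

end JacksonNetwork

/-! ### Absolutely continuous paths -/

namespace AbsolutelyContinuousOnInterval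

theorem congr_of_eqOn {X : Type*} [PseudoMetricSpace X] {f g : ℝ → X} {a b : ℝ}
    (hf : AbsolutelyContinuousOnInterval f a b) (h : EqOn f g (uIcc a b)) :
    AbsolutelyContinuousOnInterval g a b := by
  rw [absolutelyContinuousOnInterval_iff] at hf ⊢
  intro ε hε
  obtain ⟨d, hd, H⟩ := hf ε hε
  refine ⟨d, hd, fun E hE hlen => ?_⟩
  have := H E hE hlen
  rwa [Finset.sum_congr rfl fun i hi => by rw [h (hE.1 i hi).1, h (hE.1 i hi).2]] at this

/-- Precomposition with a monotone `1`-Lipschitz change of time. -/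
theorem comp_monotone {X : Type*} [PseudoMetricSpace X] {f : ℝ → X} {a b : ℝ} {φ : ℝ → ℝ}
    (hab : a ≤ b) (hφ : Monotone φ) (hφ1 : ∀ s t, dist (φ s) (φ t) ≤ dist s t)
    (hf : AbsolutelyContinuousOnInterval f (φ a) (φ b)) :
    AbsolutelyContinuousOnInterval (fun t => f (φ t)) a b := by
  rw [absolutelyContinuousOnInterval_iff] at hf ⊢
  intro ε hε
  obtain ⟨d, hd, H⟩ := hf ε hε
  refine ⟨d, hd, fun E hE hlen => ?_⟩
  refine H (E.1, fun i => (φ (E.2 i).1, φ (E.2 i).2)) ⟨fun i hi => ?_, fun i hi j hj hij => ?_⟩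
    ((Finset.sum_le_sum fun i _ => hφ1 _ _).trans_lt hlen)
  · have h1 := hE.1 i hi
    rw [uIcc_of_le hab] at h1
    rw [uIcc_of_le (hφ hab)]
    exact ⟨⟨hφ h1.1.1, hφ h1.1.2⟩, hφ h1.2.1, hφ h1.2.2⟩
  · have h1 := hE.2 hi hj hij
    simp only [Function.onFun, Set.disjoint_left, uIoc, mem_Ioc, ← hφ.map_min, ← hφ.map_max]
      at h1 ⊢
    -- If the image intervals share a point, the strict order relations between their ends reflect
    -- back through `φ`, so the original intervals share the point `min p' r'`.
    rintro u ⟨hu1, hu2⟩ ⟨hu3, hu4⟩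
    set p := min (E.2 i).1 (E.2 i).2
    set p' := max (E.2 i).1 (E.2 i).2
    set r := min (E.2 j).1 (E.2 j).2
    set r' := max (E.2 j).1 (E.2 j).2
    have h2 : p < p' := hφ.reflect_lt (hu1.trans_le hu2)
    have h3 : r < r' := hφ.reflect_lt (hu3.trans_le hu4)
    have h4 : p < r' := hφ.reflect_lt (hu1.trans_le hu4)
    have h5 : r < p' := hφ.reflect_lt (hu3.trans_le hu2)
    exact h1 ⟨lt_min h2 h4, min_le_left _ _⟩ ⟨lt_min h5 h3, min_le_right _ _⟩

end AbsolutelyContinuousOnInterval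

namespace PathSpace

variable {K : ℕ}

theorem coord_of_nonneg (q : PathSpace K) (k : Fin K) (t : ℝ≥0) : q.coord k t = q.1 t k := by
  simp [coord]

theorem IsAbsCont.continuous {q : PathSpace K} (hq : q.IsAbsCont) : Continuous q.1 := by
  refine continuous_pi fun k => ?_
  rw [NNReal.isEmbedding_coe.continuous_iff]
  refine continuous_iff_continuousAt.2 fun t => ?_
  have h1 := (hq k (t + 1) (by positivity)).continuousOn
  rw [uIcc_of_le (by positivity)] at h1
  have h2 : ContinuousOn (fun t : ℝ≥0 => q.coord k t) (Iic (t + 1)) :=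
    h1.comp NNReal.continuous_coe.continuousOn fun s hs => ⟨s.2, by exact_mod_cast hs⟩
  have h3 := h2.continuousAt (Iic_mem_nhds (by simp : t < t + 1))
  simp only [coord_of_nonneg] at h3
  exact h3

/-- The path with prescribed absolutely continuous nonnegative coordinates. -/
theorem exists_isAbsCont (f : ℝ → Fin K → ℝ) (hf0 : ∀ t, 0 ≤ t → ∀ k, 0 ≤ f t k)
    (hf : ∀ k (T : ℝ), 0 ≤ T → AbsolutelyContinuousOnInterval (fun t => f t k) 0 T) :
    ∃ q : PathSpace K, q.IsAbsCont ∧ ∀ (t : ℝ≥0) k, (q.1 t k : ℝ) = f t k := by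
  have hc : Continuous fun (t : ℝ≥0) (k : Fin K) => (f t k).toNNReal := by
    refine continuous_pi fun k => continuous_real_toNNReal.comp ?_
    refine continuous_iff_continuousAt.2 fun t => ?_
    have h1 := (hf k (t + 1) (by positivity)).continuousOn
    rw [uIcc_of_le (by positivity)] at h1
    have h2 : ContinuousOn (fun t : ℝ≥0 => f t k) (Iic (t + 1)) :=
      h1.comp NNReal.continuous_coe.continuousOn fun s hs => ⟨s.2, by exact_mod_cast hs⟩
    exact h2.continuousAt (Iic_mem_nhds (by simp : t < t + 1))
  refine ⟨⟨fun t k => (f t k).toNNReal, fun t => ⟨hc.continuousWithinAt, _,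
    (hc.tendsto t).mono_left nhdsWithin_le_nhds⟩⟩, fun k T hT => ?_, fun t k => ?_⟩
  · refine (hf k T hT).congr_of_eqOn fun t ht => ?_
    rw [uIcc_of_le hT] at ht
    simp [coord, ht.1, hf0 t ht.1 k]
  · simp [hf0 t t.2 k]

theorem IsAbsCont.comp_monotone {q : PathSpace K} (hq : q.IsAbsCont) (k : Fin K) {φ : ℝ → ℝ}
    (hφ : Monotone φ) (hφ1 : ∀ s t, dist (φ s) (φ t) ≤ dist s t) (hφ0 : 0 ≤ φ 0) {T : ℝ}
    (hT : 0 ≤ T) : AbsolutelyContinuousOnInterval (fun t => q.coord k (φ t)) 0 T := by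
  refine AbsolutelyContinuousOnInterval.comp_monotone hT hφ hφ1 ?_
  have h := hφ hT
  refine (hq k (φ T) (hφ0.trans h)).mono ?_
  rw [uIcc_of_le h, uIcc_of_le (hφ0.trans h)]
  exact Icc_subset_Icc_left hφ0

theorem velocity_eq_of_eventuallyEq {q q' : PathSpace K} {t r : ℝ}
    (h : ∀ᶠ u in 𝓝 t, q.1 u.toNNReal = q'.1 (u - r).toNNReal) :
    q.velocity t = q'.velocity (t - r) := by
  funext k
  have h1 : q.coord k =ᶠ[𝓝 t] fun u => q'.coord k (u - r) :=
    h.mono fun u hu => by simp [coord, hu]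
  have h2 : (fun u => q'.coord k (u - r)) = fun u => q'.coord k (u + -r) := rfl
  rw [velocity, velocity, h1.deriv_eq, h2, deriv_comp_add_const, sub_eq_add_neg]

/-- A straight segment run in time `τ`. -/
theorem exists_linear (x y : Orthant K) {τ : ℝ≥0} (hτ : 0 < τ) :
    ∃ q : PathSpace K, q.IsAbsCont ∧ q.1 0 = x ∧ q.1 τ = y ∧ ∀ t ∈ Ioo (0 : ℝ) τ,
      (∀ k, (q.1 t.toNNReal k : ℝ) = x k + t * ((y k - x k) / τ)) ∧
      q.velocity t = fun k => ((y k : ℝ) - x k) / τ := by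
  have hτ' : (0 : ℝ) < τ := hτ
  -- Truncating time at `τ` freezes the path at `y`, which keeps it in the orthant for all later
  -- times.
  have hpos : ∀ t : ℝ, 0 ≤ t → ∀ k, 0 ≤ (x k : ℝ) + min t τ * ((y k - x k) / τ) := by
    intro t ht k
    have h1 : min t τ / τ ≤ 1 := (div_le_one hτ').2 (min_le_right _ _)
    have h2 : 0 ≤ min t τ / τ := div_nonneg (le_min ht hτ'.le) hτ'.le
    have h3 : (x k : ℝ) + min t τ * ((y k - x k) / τ) =
        (1 - min t τ / τ) * x k + min t τ / τ * y k := by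
      field_simp
      ring
    rw [h3]
    have h4 : (0 : ℝ) ≤ x k := (x k).2
    have h5 : (0 : ℝ) ≤ y k := (y k).2
    have h6 : 0 ≤ 1 - min t τ / τ := by linarith
    positivity
  have hac : ∀ (k : Fin K) (T : ℝ), 0 ≤ T → AbsolutelyContinuousOnInterval
      (fun t : ℝ => (x k : ℝ) + min t τ * ((y k - x k) / τ)) 0 T := by
    intro k T hT
    refine LipschitzOnWith.absolutelyContinuousOnInterval
      (K := ‖((y k : ℝ) - x k) / τ‖₊) (LipschitzWith.lipschitzOnWith ?_)
    refine LipschitzWith.of_dist_le_mul fun s t => ?_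
    have h1 : dist (min s (τ : ℝ)) (min t (τ : ℝ)) ≤ dist s t := by
      have := abs_min_sub_min_le_max s (τ : ℝ) t τ
      simpa [Real.dist_eq] using this
    rw [dist_add_left, Real.dist_eq, ← sub_mul, abs_mul, mul_comm, coe_nnnorm, Real.norm_eq_abs]
    gcongr
    exact h1
  obtain ⟨q, hq, hqf⟩ := exists_isAbsCont _ hpos hac
  refine ⟨q, hq, ?_, ?_, fun t ht => ?_⟩
  · funext k
    have := hqf 0 k
    rw [← NNReal.coe_inj, this]
    simp
  · funext k
    have := hqf τ k
    rw [← NNReal.coe_inj, this, min_self]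
    field_simp
    ring
  · have h1 : ∀ u ∈ Ioo (0 : ℝ) τ, ∀ k,
        (q.1 u.toNNReal k : ℝ) = x k + u * ((y k - x k) / τ) := fun u hu k => by
      rw [hqf, Real.coe_toNNReal _ hu.1.le, min_eq_left hu.2.le]
    refine ⟨h1 t ht, funext fun k => ?_⟩
    have h2 : q.coord k =ᶠ[𝓝 t] fun u => x k + u * (((y k : ℝ) - x k) / τ) := by
      filter_upwards [isOpen_Ioo.mem_nhds ht] with u hu
      exact h1 u hu k
    rw [velocity, h2.deriv_eq]
    simp

end PathSpace

/-! ### Shifting, joining and splitting paths, with their costs -/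

namespace JacksonNetwork

variable {K : ℕ} {N : JacksonNetwork K} {c : ℝ≥0∞}

/-- The cost rate along a path. -/
noncomputable def costRate (N : JacksonNetwork K) (c : ℝ≥0∞) (q : PathSpace K) (t : ℝ) : ℝ≥0∞ :=
  N.lagrangian c (q.1 t.toNNReal) (q.velocity t)

theorem costRate_eq_of_eventuallyEq {q q' : PathSpace K} {t r : ℝ}
    (h : ∀ᶠ u in 𝓝 t, q.1 u.toNNReal = q'.1 (u - r).toNNReal) :
    N.costRate c q t = N.costRate c q' (t - r) := by
  rw [costRate, costRate, PathSpace.velocity_eq_of_eventuallyEq h, h.self_of_nhds]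

/-- Time shift of a path. -/
theorem exists_shift {q : PathSpace K} (hq : q.IsAbsCont) (r : ℝ≥0) :
    ∃ q' : PathSpace K, q'.IsAbsCont ∧ (∀ t, q'.1 t = q.1 (r + t)) ∧
      ∀ N : JacksonNetwork K, ∀ c, ∀ t : ℝ, 0 < t →
        N.costRate c q' t = N.costRate c q (r + t) := by
  obtain ⟨q', hq', hf⟩ := PathSpace.exists_isAbsCont (fun t k => q.coord k (r + t))
    (fun t _ k => NNReal.coe_nonneg _) (fun k T hT => hq.comp_monotone k
      (fun s t h => by simpa using h) (fun s t => by simp) (by simp) hT)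
  have h1 : ∀ t, q'.1 t = q.1 (r + t) := fun t => funext fun k => by
    rw [← NNReal.coe_inj, hf, ← PathSpace.coord_of_nonneg]
    simp
  refine ⟨q', hq', h1, fun N c t ht => ?_⟩
  have h2 : t - -(r : ℝ) = r + t := by ring
  have h3 := N.costRate_eq_of_eventuallyEq (c := c) (q := q') (q' := q) (t := t) (r := -(r : ℝ)) ?_
  · rw [h3, h2]
  · filter_upwards [lt_mem_nhds ht] with u hu
    refine (h1 _).trans (congrArg q.1 ?_)
    rw [← NNReal.coe_inj]
    push_cast
    rw [Real.coe_toNNReal _ hu.le, Real.coe_toNNReal _ (by linarith [r.2, hu])]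
    ring

/-- Concatenation of paths. -/
theorem exists_concat {q₁ q₂ : PathSpace K} (h₁ : q₁.IsAbsCont) (h₂ : q₂.IsAbsCont) {s : ℝ≥0}
    (h : q₂.1 0 = q₁.1 s) :
    ∃ q : PathSpace K, q.IsAbsCont ∧ (∀ t ≤ s, q.1 t = q₁.1 t) ∧ (∀ t, q.1 (s + t) = q₂.1 t) ∧
      ∀ N : JacksonNetwork K, ∀ c,
        (∀ t ∈ Ioo (0 : ℝ) s, N.costRate c q t = N.costRate c q₁ t) ∧
        ∀ t : ℝ, 0 < t → N.costRate c q (s + t) = N.costRate c q₂ t := by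
  have hmin : ∀ a b : ℝ, dist (min a (s : ℝ)) (min b (s : ℝ)) ≤ dist a b := fun a b => by
    simpa [Real.dist_eq] using abs_min_sub_min_le_max a (s : ℝ) b s
  have hmax : ∀ a b : ℝ, dist (max (a - s) 0) (max (b - s) 0) ≤ dist a b := fun a b => by
    simpa [Real.dist_eq] using abs_max_sub_max_le_max (a - s) 0 (b - s) 0
  -- One formula gives both pieces: a sum of the two paths under monotone `1`-Lipschitz time
  -- changes. Absolute continuity is inherited from this form, with no gluing argument.
  have hle : ∀ t : ℝ, t ≤ s → ∀ k, q₁.coord k (min t s) + q₂.coord k (max (t - s) 0) -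
      q₂.coord k 0 = q₁.coord k t := fun t ht k => by
    rw [min_eq_left ht, max_eq_right (by linarith)]
    ring
  have hge : ∀ t : ℝ, s ≤ t → ∀ k, q₁.coord k (min t s) + q₂.coord k (max (t - s) 0) -
      q₂.coord k 0 = q₂.coord k (t - s) := fun t ht k => by
    rw [min_eq_right ht, max_eq_left (by linarith), PathSpace.coord_of_nonneg q₁, ← h]
    have := PathSpace.coord_of_nonneg q₂ k 0
    rw [NNReal.coe_zero] at this
    rw [this]
    ring
  have hpos : ∀ t : ℝ, 0 ≤ t → ∀ k, 0 ≤ q₁.coord k (min t s) + q₂.coord k (max (t - s) 0) -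
      q₂.coord k 0 := by
    intro t _ k
    rcases le_total t s with ht | ht
    · simp only [hle t ht]; exact NNReal.coe_nonneg _
    · simp only [hge t ht]; exact NNReal.coe_nonneg _
  have hac : ∀ (k : Fin K) (T : ℝ), 0 ≤ T → AbsolutelyContinuousOnInterval (fun t : ℝ =>
      q₁.coord k (min t s) + q₂.coord k (max (t - s) 0) - q₂.coord k 0) 0 T := by
    intro k T hT
    have a1 := h₁.comp_monotone k (φ := fun t => min t s)
      (fun a b hab => min_le_min_right _ hab) hmin (by simp) hT
    have a2 := h₂.comp_monotone k (φ := fun t => max (t - s) 0)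
      (fun a b hab => max_le_max_right _ (by linarith)) hmax (by simp) hT
    have a3 : AbsolutelyContinuousOnInterval (fun _ : ℝ => q₂.coord k 0) 0 T :=
      LipschitzOnWith.absolutelyContinuousOnInterval (K := 0)
        ((LipschitzWith.const _).lipschitzOnWith)
    exact (a1.add a2).sub a3
  obtain ⟨q, hq, hf⟩ := PathSpace.exists_isAbsCont _ hpos hac
  have e1 : ∀ t ≤ s, q.1 t = q₁.1 t := fun t ht => funext fun k => by
    rw [← NNReal.coe_inj, hf, hle t (by exact_mod_cast ht), PathSpace.coord_of_nonneg]
  have e2 : ∀ t, q.1 (s + t) = q₂.1 t := fun t => funext fun k => by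
    rw [← NNReal.coe_inj, hf, hge _ (by simp), ← PathSpace.coord_of_nonneg]
    simp
  refine ⟨q, hq, e1, e2, fun N c => ⟨fun t ht => ?_, fun t ht => ?_⟩⟩
  · have h3 := N.costRate_eq_of_eventuallyEq (c := c) (q := q) (q' := q₁) (t := t) (r := 0) ?_
    · rw [h3, sub_zero]
    · filter_upwards [isOpen_Ioo.mem_nhds ht] with u hu
      rw [sub_zero]
      exact e1 _ (Real.toNNReal_le_iff_le_coe.2 hu.2.le)
  · have h3 := N.costRate_eq_of_eventuallyEq (c := c) (q := q) (q' := q₂) (t := s + t) (r := s) ?_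
    · rw [h3, add_sub_cancel_left]
    · filter_upwards [lt_mem_nhds (by linarith : (s : ℝ) < s + t)] with u hu
      refine Eq.trans (congrArg q.1 ?_) (e2 _)
      rw [← NNReal.coe_inj]
      push_cast
      rw [Real.coe_toNNReal _ (s.2.trans hu.le), Real.coe_toNNReal _ (by linarith)]
      ring

theorem setLIntegral_Ioc_add_left (g : ℝ → ℝ≥0∞) (s t : ℝ) :
    ∫⁻ u in Ioc 0 t, g (s + u) = ∫⁻ u in Ioc s (s + t), g u := by
  have h := (measurePreserving_add_left volume s).setLIntegral_comp_preimage_emb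
    (measurableEmbedding_addLeft s) g (Ioc s (s + t))
  rw [← h]
  congr 2
  ext; simp

theorem setLIntegral_Ioi_add_left (g : ℝ → ℝ≥0∞) (s : ℝ) :
    ∫⁻ u in Ioi 0, g (s + u) = ∫⁻ u in Ioi s, g u := by
  have h := (measurePreserving_add_left volume s).setLIntegral_comp_preimage_emb
    (measurableEmbedding_addLeft s) g (Ioi s)
  rw [← h]
  congr 2
  ext; simp

/-- `y` can be reached from `x` in time `t` at cost at most `a`. -/
def Reach (N : JacksonNetwork K) (c : ℝ≥0∞) (x y : Orthant K) (t : ℝ≥0) (a : ℝ≥0∞) : Prop :=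
  ∃ q : PathSpace K, q.IsAbsCont ∧ q.1 0 = x ∧ q.1 t = y ∧
    ∫⁻ s in Ioc (0 : ℝ) t, N.costRate c q s ≤ a

theorem Reach.trans {x y z : Orthant K} {s t : ℝ≥0} {a b : ℝ≥0∞} (h₁ : N.Reach c x y s a)
    (h₂ : N.Reach c y z t b) : N.Reach c x z (s + t) (a + b) := by
  obtain ⟨q₁, hq₁, h10, h1s, h1c⟩ := h₁
  obtain ⟨q₂, hq₂, h20, h2t, h2c⟩ := h₂
  obtain ⟨q, hq, e1, e2, e3⟩ := exists_concat hq₁ hq₂ (h20.trans h1s.symm)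
  obtain ⟨e3, e4⟩ := e3 N c
  refine ⟨q, hq, (e1 0 zero_le).trans h10, (e2 t).trans h2t, ?_⟩
  have h3 : Ioc (0 : ℝ) ↑(s + t) = Ioc 0 (s : ℝ) ∪ Ioc (s : ℝ) (s + t) := by
    rw [NNReal.coe_add, Ioc_union_Ioc_eq_Ioc s.coe_nonneg (by simp)]
  -- The velocities are known to agree only off the junction time, hence the passage through open
  -- intervals.
  rw [h3, lintegral_union measurableSet_Ioc (Ioc_disjoint_Ioc_of_le le_rfl),
    ← setLIntegral_Ioc_add_left, setLIntegral_congr Ioo_ae_eq_Ioc.symm,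
    setLIntegral_congr_fun measurableSet_Ioo e3, setLIntegral_congr Ioo_ae_eq_Ioc,
    setLIntegral_congr_fun measurableSet_Ioc fun u hu => e4 u hu.1]
  exact add_le_add h1c h2c

/-- A straight segment of bounded rate. -/
theorem reach_linear (x y : Orthant K) {τ : ℝ≥0} (hτ : 0 < τ) {C : ℝ≥0∞}
    (h : ∀ z : Orthant K, (∃ t ∈ Ioo (0 : ℝ) τ, ∀ k, (z k : ℝ) = x k + t * ((y k - x k) / τ)) →
      N.lagrangian c z (fun k => ((y k : ℝ) - x k) / τ) ≤ C) :
    N.Reach c x y τ (C * τ) := by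
  obtain ⟨q, hq, h0, h1, h2⟩ := PathSpace.exists_linear x y hτ
  refine ⟨q, hq, h0, h1, ?_⟩
  rw [setLIntegral_congr Ioo_ae_eq_Ioc.symm]
  calc ∫⁻ s in Ioo (0 : ℝ) τ, N.costRate c q s ≤ ∫⁻ s in Ioo (0 : ℝ) τ, C := by
        refine setLIntegral_mono' measurableSet_Ioo fun t ht => ?_
        rw [costRate, (h2 t ht).2]
        exact h _ ⟨t, ht, (h2 t ht).1⟩
    _ = C * τ := by simp

/-- A segment of a path of finite cost. -/
theorem reach_of_path {q : PathSpace K} (hq : q.IsAbsCont) {r t : ℝ≥0} {a : ℝ≥0∞}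
    (ha : ∫⁻ s in Ioc (r : ℝ) (r + t), N.costRate c q s ≤ a) :
    N.Reach c (q.1 r) (q.1 (r + t)) t a := by
  obtain ⟨q', hq', h1, h2⟩ := exists_shift hq r
  refine ⟨q', hq', by simp [h1], h1 t, ?_⟩
  rw [setLIntegral_congr_fun measurableSet_Ioc fun u hu => h2 N c u hu.1,
    setLIntegral_Ioc_add_left]
  exact ha

theorem Reach.mono {x y : Orthant K} {t : ℝ≥0} {a b : ℝ≥0∞} (h : N.Reach c x y t a)
    (hab : a ≤ b) : N.Reach c x y t b := by
  obtain ⟨q, h1, h2, h3, h4⟩ := h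
  exact ⟨q, h1, h2, h3, h4.trans hab⟩

/-- A path of finite cost splits at any intermediate time. -/
theorem Reach.split {x y : Orthant K} {s t : ℝ≥0} {a : ℝ≥0∞} (h : N.Reach c x y (s + t) a) :
    ∃ z a₁ a₂, N.Reach c x z s a₁ ∧ N.Reach c z y t a₂ ∧ a₁ + a₂ ≤ a := by
  obtain ⟨q, hq, h0, h1, h2⟩ := h
  have h4 : N.Reach c (q.1 s) (q.1 (s + t)) t _ := reach_of_path hq le_rfl
  rw [h1] at h4
  refine ⟨q.1 s, _, _, ⟨q, hq, h0, rfl, le_rfl⟩, h4, ?_⟩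
  have h3 : Ioc (0 : ℝ) ↑(s + t) = Ioc 0 (s : ℝ) ∪ Ioc (s : ℝ) (s + t) := by
    rw [NNReal.coe_add, Ioc_union_Ioc_eq_Ioc s.coe_nonneg (by simp)]
  rwa [h3, lintegral_union measurableSet_Ioc (Ioc_disjoint_Ioc_of_le le_rfl)] at h2

/-- The origin is a rest point. -/
theorem IsAdmissible.exists_rest (hN : N.IsAdmissible) (hsub : N.IsSubcritical) :
    ∃ q : PathSpace K, q.IsAbsCont ∧ (∀ t, q.1 t = 0) ∧ ∀ c t, N.costRate c q t = 0 := by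
  obtain ⟨q, hq, hf⟩ := PathSpace.exists_isAbsCont (K := K) (fun _ _ => 0) (by simp)
    (fun k T hT => LipschitzOnWith.absolutelyContinuousOnInterval (K := 0)
      ((LipschitzWith.const _).lipschitzOnWith))
  have h0 : ∀ t, q.1 t = 0 := fun t => funext fun k => by
    rw [← NNReal.coe_inj, hf]; rfl
  refine ⟨q, hq, h0, fun c t => ?_⟩
  have h1 := hN.lagrangian_fluid (c := c) (q.1 t.toNNReal) (fun k => (hN.throughput_pos k).le)
    (fun k => (hsub k).le) (fun k hk => absurd (congrFun (h0 _) k) hk)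
  have h2 : N.arrivalRate + (N.routingᵀ - 1) *ᵥ N.throughput = q.velocity t := by
    have h3 : q.velocity t = 0 := funext fun k => by
      have : q.coord k = fun _ => 0 := funext fun u => by simp [PathSpace.coord, h0]
      simp [PathSpace.velocity, this]
    rw [h3, Matrix.sub_mulVec, Matrix.one_mulVec, ← add_sub_assoc, ← hN.throughput_eq, sub_self]
  rw [costRate, ← h2, h1]

theorem IsAdmissible.reach_rest (hN : N.IsAdmissible) (hsub : N.IsSubcritical) (t : ℝ≥0) :
    N.Reach c 0 0 t 0 := by
  obtain ⟨q, hq, h0, h1⟩ := hN.exists_rest hsub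
  exact ⟨q, hq, h0 0, h0 t, by simp [h1]⟩

theorem reach_refl (x : Orthant K) : N.Reach c x x 0 0 := by
  obtain ⟨q, hq, h0, _⟩ := PathSpace.exists_linear x x (τ := 1) one_pos
  exact ⟨q, hq, h0, h0, by simp⟩

/-- The action integrates over the whole half-line, so the path must be continued after time `t`:
from `y` it drains to the origin and rests there, all at no cost. -/
theorem Reach.exists_action_le {x y : Orthant K} {t : ℝ≥0} {a : ℝ≥0∞} (hN : N.IsAdmissible)
    (hsub : N.IsSubcritical) (h : N.Reach c x y t a) {s : ℝ≥0} (hy : N.Reach c y 0 s 0) :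
    ∃ q : PathSpace K, q.1 t = y ∧ N.action c x q ≤ a := by
  obtain ⟨q₁, hq₁, h10, h1t, h1c⟩ := h
  obtain ⟨q₂, hq₂, h20, h2s, h2c⟩ := hy
  obtain ⟨q₀, hq₀, h00, h0c⟩ := hN.exists_rest hsub
  obtain ⟨q₃, hq₃, e1, e2, e3⟩ := exists_concat hq₂ hq₀ ((h00 0).trans h2s.symm)
  have h30 : q₃.1 0 = y := (e1 0 zero_le).trans h20
  have h3c : ∫⁻ u in Ioi (0 : ℝ), N.costRate c q₃ u = 0 := by
    obtain ⟨e3, e4⟩ := e3 N c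
    rw [← Ioc_union_Ioi_eq_Ioi (show (0 : ℝ) ≤ s from s.2), lintegral_union measurableSet_Ioi
      (Ioc_disjoint_Ioi le_rfl), ← setLIntegral_Ioi_add_left,
      setLIntegral_congr Ioo_ae_eq_Ioc.symm, setLIntegral_congr_fun measurableSet_Ioo e3,
      setLIntegral_congr Ioo_ae_eq_Ioc,
      setLIntegral_congr_fun measurableSet_Ioi fun u hu => e4 u hu, nonpos_iff_eq_zero.1 h2c]
    simp [h0c]
  obtain ⟨q, hq, f1, f2, f3⟩ := exists_concat hq₁ hq₃ (h30.trans h1t.symm)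
  obtain ⟨f3, f4⟩ := f3 N c
  refine ⟨q, (f1 t le_rfl).trans h1t, ?_⟩
  rw [action, if_pos ⟨hq, (f1 0 zero_le).trans h10⟩]
  change ∫⁻ u in Ioi (0 : ℝ), N.costRate c q u ≤ a
  rw [← Ioc_union_Ioi_eq_Ioi (show (0 : ℝ) ≤ t from t.2), lintegral_union measurableSet_Ioi
    (Ioc_disjoint_Ioi le_rfl), ← setLIntegral_Ioi_add_left,
    setLIntegral_congr Ioo_ae_eq_Ioc.symm, setLIntegral_congr_fun measurableSet_Ioo f3,
    setLIntegral_congr Ioo_ae_eq_Ioc,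
    setLIntegral_congr_fun measurableSet_Ioi fun u hu => f4 u hu, h3c, add_zero]
  exact h1c

theorem reach_of_action_lt {x : Orthant K} {t : ℝ≥0} {a : ℝ≥0∞} {q : PathSpace K}
    (h : N.action c x q < a) : N.Reach c x (q.1 t) t a := by
  unfold action at h
  split_ifs at h with h1
  · exact ⟨q, h1.1, h1.2, rfl, (lintegral_mono_set Ioc_subset_Ioi_self).trans h.le⟩
  · exact absurd h not_top_lt

end JacksonNetwork

/-! ### The Lyapunov inequality along paths -/

namespace PathSpace

variable {K : ℕ}

/-- A nonnegative coordinate that vanishes is at a minimum. No differentiability is needed, since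
`deriv` is zero where the derivative fails to exist. -/
theorem velocity_eq_zero {q : PathSpace K} {t : ℝ} {k : Fin K} (h : q.1 t.toNNReal k = 0) :
    q.velocity t k = 0 := by
  refine IsLocalMin.deriv_eq_zero (Eventually.of_forall fun u => ?_)
  have h1 : q.coord k t = 0 := by simp [coord, h]
  rw [h1]
  exact NNReal.coe_nonneg _

/-- Integration of a differential inequality along a path. -/
theorem IsAbsCont.add_mul_le {q : PathSpace K} (hq : q.IsAbsCont) (v : Fin K → ℝ) (β : ℝ)
    (T : ℝ≥0) (g : ℝ → ℝ≥0∞)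
    (h : ∀ t ∈ Ioo (0 : ℝ) T, ENNReal.ofReal (v ⬝ᵥ q.velocity t + β) ≤ g t) :
    ENNReal.ofReal (∑ k, v k * q.1 T k - ∑ k, v k * q.1 0 k + β * T) ≤
      ∫⁻ t in Ioc (0 : ℝ) T, g t := by
  have hT : (0 : ℝ) ≤ T := T.coe_nonneg
  have hint : ∀ k, IntervalIntegrable (deriv (q.coord k)) volume 0 T := fun k =>
    (hq k T hT).intervalIntegrable_deriv
  have hintv : IntervalIntegrable (fun t => v ⬝ᵥ q.velocity t) volume 0 T := by
    have := IntervalIntegrable.sum Finset.univ fun k (_ : k ∈ Finset.univ) =>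
      (hint k).const_mul (v k)
    refine this.congr fun t _ => ?_
    simp [dotProduct, velocity]
  have hint' : IntervalIntegrable (fun t => v ⬝ᵥ q.velocity t + β) volume 0 T :=
    hintv.add intervalIntegrable_const
  have hval : ∫ t in (0 : ℝ)..T, (v ⬝ᵥ q.velocity t + β) =
      ∑ k, v k * q.1 T k - ∑ k, v k * q.1 0 k + β * T := by
    rw [intervalIntegral.integral_add hintv intervalIntegrable_const]
    congr 1
    · have h1 : ∫ t in (0 : ℝ)..T, v ⬝ᵥ q.velocity t =
          ∑ k, ∫ t in (0 : ℝ)..T, v k * deriv (q.coord k) t :=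
        intervalIntegral.integral_finsetSum fun k _ => (hint k).const_mul (v k)
      rw [h1, ← Finset.sum_sub_distrib]
      refine Finset.sum_congr rfl fun k _ => ?_
      rw [intervalIntegral.integral_const_mul, (hq k T hT).integral_deriv_eq_sub,
        coord_of_nonneg, mul_sub]
      have := coord_of_nonneg q k 0
      rw [NNReal.coe_zero] at this
      rw [this]
    · simp [mul_comm]
  rw [← hval, intervalIntegral.integral_of_le hT]
  rw [intervalIntegrable_iff_integrableOn_Ioc_of_le hT] at hint'
  -- The bound on `g` only sees positive parts. The final comparison is monotonicity of the lower
  -- integral, so `g` need not be measurable.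
  have h1 : ∫ t in Ioc (0 : ℝ) T, (v ⬝ᵥ q.velocity t + β) ≤
      ∫ t in Ioc (0 : ℝ) T, max (v ⬝ᵥ q.velocity t + β) 0 :=
    integral_mono hint' hint'.pos_part fun t => le_max_left _ _
  refine (ENNReal.ofReal_le_ofReal h1).trans ?_
  rw [ofReal_integral_eq_lintegral_ofReal hint'.pos_part
    (Eventually.of_forall fun t => le_max_right _ _), setLIntegral_congr Ioo_ae_eq_Ioc.symm,
    setLIntegral_congr (f := g) Ioo_ae_eq_Ioc.symm]
  refine setLIntegral_mono' measurableSet_Ioo fun t ht => ?_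
  rw [ENNReal.ofReal_max, ENNReal.ofReal_zero, max_eq_left zero_le]
  exact h t ht

end PathSpace

namespace JacksonNetwork

variable {K : ℕ} {N : JacksonNetwork K} {c : ℝ≥0∞}

/-- Linear functions decreasing along cheap paths. -/
structure IsLyapunov (N : JacksonNetwork K) (c : ℝ≥0∞) (v : Fin K → ℝ) (b C : ℝ) : Prop where
  one_le : ∀ k, 1 ≤ v k
  pos : 0 < b
  const_pos : 0 < C
  le_lagrangian : ∀ (x : Orthant K) (y : Fin K → ℝ), x ≠ 0 → (∀ k, x k = 0 → y k = 0) →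
    ENNReal.ofReal (v ⬝ᵥ y + b) ≤ ENNReal.ofReal C * N.lagrangian c x y

/-- The weighted content of the network. -/
def content (v : Fin K → ℝ) (x : Orthant K) : ℝ := ∑ k, v k * x k

namespace IsLyapunov

variable {v : Fin K → ℝ} {b C : ℝ}

theorem content_nonneg (h : N.IsLyapunov c v b C) (x : Orthant K) : 0 ≤ content v x :=
  Finset.sum_nonneg fun k _ => mul_nonneg (zero_le_one.trans (h.one_le k)) (x k).2

theorem le_content (h : N.IsLyapunov c v b C) (x : Orthant K) (k : Fin K) :
    (x k : ℝ) ≤ content v x :=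
  (le_mul_of_one_le_left (x k).2 (h.one_le k)).trans
    (Finset.single_le_sum (f := fun k => v k * (x k : ℝ))
      (fun k _ => mul_nonneg (zero_le_one.trans (h.one_le k)) (x k).2) (Finset.mem_univ k))

/-- Integrated Lyapunov inequality. At visits to the origin the velocity vanishes and only `β ≤ 0`
can be allowed; on stretches that avoid the origin one may take `β = b`. -/
theorem content_add_le (h : N.IsLyapunov c v b C) {q : PathSpace K} (hq : q.IsAbsCont) {T : ℝ≥0}
    {β : ℝ} (hβ : β ≤ b) (hz : ∀ t ∈ Ioo (0 : ℝ) T, q.1 t.toNNReal = 0 → β ≤ 0) {a : ℝ}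
    (ha0 : 0 ≤ a) (ha : ∫⁻ t in Ioc (0 : ℝ) T, N.costRate c q t ≤ ENNReal.ofReal a) :
    content v (q.1 T) + β * T ≤ content v (q.1 0) + C * a := by
  have h1 := hq.add_mul_le v β T (fun t => ENNReal.ofReal C * N.costRate c q t) fun t ht => ?_
  · rw [lintegral_const_mul' _ _ ENNReal.ofReal_ne_top] at h1
    have h2 := h1.trans (mul_le_mul_right ha (ENNReal.ofReal C))
    rw [← ENNReal.ofReal_mul h.const_pos.le,
      ENNReal.ofReal_le_ofReal_iff (mul_nonneg h.const_pos.le ha0)] at h2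
    unfold content
    linarith
  · by_cases h0 : q.1 t.toNNReal = 0
    · have h1 : v ⬝ᵥ q.velocity t = 0 :=
        Finset.sum_eq_zero fun k _ => by rw [PathSpace.velocity_eq_zero (congrFun h0 k), mul_zero]
      rw [h1, zero_add, ENNReal.ofReal_of_nonpos (hz t ht h0)]
      exact zero_le
    · refine (ENNReal.ofReal_le_ofReal ?_).trans (h.le_lagrangian (q.1 t.toNNReal) (q.velocity t)
        h0 fun k hk => PathSpace.velocity_eq_zero hk)
      linarith

/-- Reaching a state costs at least a multiple of its content. -/
theorem content_le (h : N.IsLyapunov c v b C) {x y : Orthant K} {t : ℝ≥0} {a : ℝ} (ha0 : 0 ≤ a)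
    (hr : N.Reach c x y t (ENNReal.ofReal a)) : content v y ≤ content v x + C * a := by
  obtain ⟨q, hq, rfl, rfl, hc⟩ := hr
  have := h.content_add_le hq (β := 0) h.pos.le (fun _ _ _ => le_rfl) ha0 hc
  linarith

/-- A long path passes through the origin, and only the part after its last visit there
matters. -/
theorem exists_last_visit (h : N.IsLyapunov c v b C) {x y : Orthant K} {t : ℝ≥0} {a : ℝ}
    (ha0 : 0 ≤ a) (hr : N.Reach c x y t (ENNReal.ofReal a))
    (hx : x = 0 ∨ content v x + C * a < b * t) :
    ∃ t' ≤ t, b * t' ≤ C * a ∧ N.Reach c 0 y t' (ENNReal.ofReal a) := by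
  obtain ⟨q, hq, h0, rfl, hc⟩ := hr
  have hcont := hq.continuous
  set Z : Set ℝ≥0 := Icc 0 t ∩ q.1 ⁻¹' {0}
  have hZc : IsCompact Z := isCompact_Icc.inter_right (isClosed_singleton.preimage hcont)
  have hZne : Z.Nonempty := by
    rcases hx with rfl | hx
    · exact ⟨0, ⟨le_rfl, zero_le⟩, h0⟩
    · by_contra hemp
      -- Without a visit the content would have to become negative by time `t`.
      have h1 := h.content_add_le hq (β := b) le_rfl (fun s hs hs0 => absurd
        (show s.toNNReal ∈ Z from ⟨⟨zero_le, Real.toNNReal_le_iff_le_coe.2 hs.2.le⟩, hs0⟩)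
        fun hmem => hemp ⟨_, hmem⟩) ha0 hc
      have h2 := h.content_nonneg (q.1 t)
      rw [h0] at h1
      linarith
  obtain ⟨s, ⟨⟨_, hst⟩, hs0⟩, hmax⟩ := hZc.exists_isGreatest hZne
  have hs0 : q.1 s = 0 := hs0
  have hst' : s + (t - s) = t := add_tsub_cancel_of_le hst
  have hcs : ∫⁻ u in Ioc (s : ℝ) (s + ↑(t - s)), N.costRate c q u ≤ ENNReal.ofReal a := by
    refine le_trans (lintegral_mono_set (Ioc_subset_Ioc s.coe_nonneg ?_)) hc
    exact_mod_cast hst'.le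
  have hreach := reach_of_path hq hcs
  refine ⟨t - s, tsub_le_self, ?_, by rwa [hs0, hst'] at hreach⟩
  obtain ⟨q', hq', e1, e2⟩ := exists_shift hq s
  rw [← setLIntegral_Ioc_add_left,
    ← setLIntegral_congr_fun measurableSet_Ioc fun u hu => e2 N c u hu.1] at hcs
  -- After the last visit the full rate `b` applies, starting from content zero; this bounds the
  -- remaining time.
  have h1 := h.content_add_le hq' (β := b) le_rfl (fun u hu hu0 => ?_) ha0 hcs
  · have h2 := h.content_nonneg (q'.1 (t - s))
    have h3 : content v (q'.1 0) = 0 := by rw [e1, add_zero, hs0]; simp [content]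
    linarith
  · exfalso
    rw [e1] at hu0
    have h3 : s + u.toNNReal ≤ t := by
      rw [← hst']
      exact add_le_add_right (Real.toNNReal_le_iff_le_coe.2 hu.2.le) s
    have h4 := hmax ⟨⟨zero_le, h3⟩, hu0⟩
    have h5 : 0 < u.toNNReal := Real.toNNReal_pos.2 hu.1
    exact (lt_add_of_pos_right s h5).not_ge h4

/-- The first visit to the origin along a free path occurs soon. -/
theorem exists_first_visit (h : N.IsLyapunov c v b C) {x : Orthant K} {t : ℝ≥0}
    (hr : N.Reach c x 0 t 0) : ∃ t' : ℝ≥0, b * t' ≤ content v x ∧ N.Reach c x 0 t' 0 := by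
  obtain ⟨q, hq, rfl, ht, hc⟩ := hr
  have hcont := hq.continuous
  have hZc : IsCompact (Icc 0 t ∩ q.1 ⁻¹' {0}) :=
    isCompact_Icc.inter_right (isClosed_singleton.preimage hcont)
  obtain ⟨s, ⟨⟨_, hst⟩, hs0⟩, hmin⟩ := hZc.exists_isLeast ⟨t, ⟨zero_le, le_rfl⟩, ht⟩
  have hs0 : q.1 s = 0 := hs0
  have hcs : ∫⁻ u in Ioc (0 : ℝ) s, N.costRate c q u ≤ 0 :=
    (lintegral_mono_set (Ioc_subset_Ioc_right (by exact_mod_cast hst))).trans hc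
  refine ⟨s, ?_, ⟨q, hq, rfl, hs0, hcs⟩⟩
  have h1 := h.content_add_le hq (T := s) (β := b) le_rfl (fun u hu hu0 => ?_) le_rfl
    (hcs.trans zero_le)
  · have h2 := h.content_nonneg (q.1 s)
    linarith
  · exfalso
    have h3 : u.toNNReal < s := by
      rw [← NNReal.coe_lt_coe, Real.coe_toNNReal _ hu.1.le]
      exact hu.2
    exact h3.not_ge (hmin ⟨⟨zero_le, h3.le.trans hst⟩, hu0⟩)

end IsLyapunov

/-! ### Fluid paths that empty the network at no cost -/

/-- The departure rates when exactly the stations in `S` are saturated. -/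
theorem IsAdmissible.exists_departureRates (hN : N.IsAdmissible) (S : Finset (Fin K)) :
    ∃ δ : Fin K → ℝ, (∀ k, 0 ≤ δ k) ∧ (∀ k, δ k ≤ N.serviceRate k) ∧
      (∀ k ∈ S, δ k = N.serviceRate k) ∧
      ∀ k ∉ S, δ k = min (N.serviceRate k) ((N.arrivalRate + N.routingᵀ *ᵥ δ) k) := by
  have hμ : (0 : Fin K → ℝ) ≤ N.serviceRate := fun k => (hN.serviceRate_pos k).le
  let F : (Fin K → ℝ) → Fin K → ℝ := fun δ k =>
    if k ∈ S then N.serviceRate k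
    else min (N.serviceRate k) ((N.arrivalRate + N.routingᵀ *ᵥ δ) k)
  have hFmono : Monotone F := fun δ δ' h k => by
    simp only [F]
    split_ifs
    · exact le_rfl
    · exact min_le_min_left _ (add_le_add_right
        (Matrix.mulVec_mono_of_nonneg hN.routing_transpose_nonneg h k) _)
  have hFmem : ∀ δ, 0 ≤ δ → F δ ∈ Icc 0 N.serviceRate := fun δ hδ => by
    refine ⟨fun k => ?_, fun k => ?_⟩
    · simp only [F]
      split_ifs
      · exact hμ k
      · refine le_min (hμ k) (add_nonneg (hN.arrivalRate_pos k).le ?_)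
        exact (Finset.sum_nonneg fun l _ => mul_nonneg (hN.routing_transpose_nonneg k l) (hδ l) :
          0 ≤ ∑ l, N.routingᵀ k l * δ l)
    · simp only [F]
      split_ifs
      · exact le_rfl
      · exact min_le_left _ _
  -- The fixed point comes from Knaster–Tarski on the order interval `[0, μ]`; the `Fact` makes it a
  -- complete lattice.
  have : Fact ((0 : Fin K → ℝ) ≤ N.serviceRate) := ⟨hμ⟩
  let G : Icc 0 N.serviceRate →o Icc 0 N.serviceRate :=
    ⟨fun δ => ⟨F δ.1, hFmem δ.1 δ.2.1⟩, fun δ δ' h => hFmono h⟩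
  have hfix : F (OrderHom.lfp G).1 = (OrderHom.lfp G).1 := congrArg Subtype.val G.map_lfp
  refine ⟨(OrderHom.lfp G).1, (OrderHom.lfp G).2.1, (OrderHom.lfp G).2.2, fun k hk => ?_,
    fun k hk => ?_⟩
  · rw [← hfix]; simp [F, hk]
  · conv_lhs => rw [← hfix]
    simp [F, hk]

/-- If the stations in `S` are saturated and the other ones are empty and stay so, then the
network empties at no cost. -/
theorem IsAdmissible.exists_reach_zero_of_saturated (hN : N.IsAdmissible)
    (hsub : N.IsSubcritical) (n : ℕ) : ∀ (S : Finset (Fin K)), S.card ≤ n →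
    ∀ (δ w : Fin K → ℝ), w = N.arrivalRate + (N.routingᵀ - 1) *ᵥ δ → (∀ k, 0 ≤ δ k) →
    (∀ k, δ k ≤ N.serviceRate k) → (∀ k ∈ S, δ k = N.serviceRate k) → (∀ k ∉ S, w k = 0) →
    ∀ x : Orthant K, (∀ k ∉ S, x k = 0) → (∀ k ∈ S, x k = 0 → 0 ≤ w k) →
    ∃ t, N.Reach c x 0 t 0 := by
  have hP := hN.hasMaxPrinciple_transpose
  induction n with
  | zero =>
    intro S hS δ w _ _ _ _ _ x hx _
    have hS : S = ∅ := by simpa using hS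
    have : x = 0 := funext fun k => hx k (by simp [hS])
    exact ⟨0, this ▸ reach_refl _⟩
  | succ n ih =>
    intro S hS δ w hw hδ hδμ hδS hwS x hxS hxw
    have hwk : ∀ k, w k = N.arrivalRate k + (N.routingᵀ *ᵥ δ) k - δ k := fun k => by
      rw [hw, Matrix.sub_mulVec, Matrix.one_mulVec]
      simp only [Pi.add_apply, Pi.sub_apply]
      ring
    rcases S.eq_empty_or_nonempty with rfl | ⟨k₀, hk₀⟩
    · have : x = 0 := funext fun k => hxS k (by simp)
      exact ⟨0, this ▸ reach_refl _⟩
    -- Were no saturated station draining, `δ` would lie below the throughput, and subcriticality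
    -- would fail at `k₀`.
    have hneg : ∃ k ∈ S, w k < 0 := by
      by_contra! hcon
      have h1 : δ ≤ N.throughput := hP.le_resolvent fun k => by
        have h2 : 0 ≤ w k := by
          by_cases hk : k ∈ S
          · exact hcon k hk
          · exact (hwS k hk).ge
        have := hwk k
        simp only [Pi.add_apply]
        linarith
      have h2 := h1 k₀
      rw [hδS k₀ hk₀] at h2
      exact (hsub k₀).not_ge h2
    -- `k₁` is the first draining station to empty. Moving straight until then loses it from the set
    -- of nonempty stations, and gains none outside `S`; this drives the induction.
    obtain ⟨k₁, hk₁, hmin⟩ := (S.filter fun k => w k < 0).exists_min_image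
      (fun k => (x k : ℝ) / (-w k)) (by
        obtain ⟨k, hk, hk'⟩ := hneg
        exact ⟨k, Finset.mem_filter.2 ⟨hk, hk'⟩⟩)
    rw [Finset.mem_filter] at hk₁
    obtain ⟨hk₁S, hk₁w⟩ := hk₁
    have hx₁ : 0 < (x k₁ : ℝ) := by
      refine lt_of_le_of_ne (x k₁).2 fun h => hk₁w.not_ge (hxw k₁ hk₁S ?_)
      exact_mod_cast h.symm
    have hτ0 : 0 < (x k₁ : ℝ) / (-w k₁) := div_pos hx₁ (by linarith)
    obtain ⟨τ, hτ⟩ : ∃ τ : ℝ≥0, (τ : ℝ) = x k₁ / (-w k₁) := ⟨⟨_, hτ0.le⟩, rfl⟩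
    rw [← hτ] at hτ0
    have hτpos : 0 < τ := by exact_mod_cast hτ0
    have hypos : ∀ k, 0 ≤ (x k : ℝ) + τ * w k := fun k => by
      rcases le_or_gt 0 (w k) with h | h
      · have : (0 : ℝ) ≤ x k := (x k).2
        positivity
      · have hkS : k ∈ S := by
          by_contra hk
          exact h.ne (hwS k hk)
        have h1 := hmin k (Finset.mem_filter.2 ⟨hkS, h⟩)
        rw [← hτ, le_div_iff₀ (by linarith)] at h1
        linarith
    obtain ⟨y, hy⟩ : ∃ y : Orthant K, ∀ k, (y k : ℝ) = x k + τ * w k :=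
      ⟨fun k => ⟨_, hypos k⟩, fun k => rfl⟩
    have hyx : (fun k => ((y k : ℝ) - x k) / τ) = w := funext fun k => by
      rw [hy]
      field_simp
      ring
    have hstep : N.Reach c x y τ (0 * τ) := by
      refine reach_linear x y hτpos fun z ⟨t, ht, hz⟩ => ?_
      rw [hyx, hw]
      refine (hN.lagrangian_fluid z hδ hδμ fun k hk => hδS k ?_).le
      by_contra hkS
      refine hk ?_
      have h1 := hz k
      have h2 := congrFun hyx k
      rw [h2, hwS k hkS, hxS k hkS] at h1
      simpa using h1
    rw [zero_mul] at hstep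
    obtain ⟨δ', h1', h2', h3', h4'⟩ :=
      hN.exists_departureRates (Finset.univ.filter fun k => y k ≠ 0)
    have hyS : ∀ k ∉ S, y k = 0 := fun k hk => by
      rw [← NNReal.coe_inj, hy, hwS k hk, hxS k hk]
      simp
    have hyk₁ : y k₁ = 0 := by
      rw [← NNReal.coe_inj, hy, hτ]
      have : -w k₁ ≠ 0 := by linarith
      have : w k₁ ≠ 0 := hk₁w.ne
      field_simp
      simp
    have hcard : (Finset.univ.filter fun k => y k ≠ 0).card ≤ n := by
      refine Nat.lt_succ_iff.1 (lt_of_lt_of_le (Finset.card_lt_card ?_) hS)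
      refine ⟨fun k hk => ?_, fun hsubset => ?_⟩
      · by_contra hkS
        exact (Finset.mem_filter.1 hk).2 (hyS k hkS)
      · exact (Finset.mem_filter.1 (hsubset hk₁S)).2 hyk₁
    -- Departure rates can only drop at the change of regime, by the maximum principle. This keeps
    -- newly emptied stations from refilling.
    have hδle : ∀ k, δ' k ≤ δ k := fun k => by
      have := hP (δ' - δ) (fun k => ?_) k
      · simpa using this
      by_cases hk : k ∈ S
      · left
        rw [Pi.sub_apply, hδS k hk]
        linarith [h2' k]
      · right
        have h5 := h4' k (by simp [hyS k hk])
        have h6 : δ' k ≤ (N.arrivalRate + N.routingᵀ *ᵥ δ') k := h5.le.trans (min_le_right _ _)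
        have h7 := hwk k
        rw [hwS k hk] at h7
        rw [Matrix.mulVec_sub]
        simp only [Pi.add_apply, Pi.sub_apply] at *
        linarith
    -- If the cap `μ` is attained at an empty station, then `δ' = δ = μ` there. The old velocity was
    -- nonpositive, as the station is now empty, and inflow has not grown, so inflow again equals
    -- `μ`.
    have hw' : ∀ k ∉ Finset.univ.filter fun k => y k ≠ 0,
        (N.arrivalRate + (N.routingᵀ - 1) *ᵥ δ' : Fin K → ℝ) k = 0 := by
      intro k hk
      have hyk : y k = 0 := by simpa using hk
      have h5 := h4' k hk
      rw [Matrix.sub_mulVec, Matrix.one_mulVec]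
      simp only [Pi.add_apply, Pi.sub_apply] at h5 ⊢
      rcases le_total (N.arrivalRate k + (N.routingᵀ *ᵥ δ') k) (N.serviceRate k) with h6 | h6
      · rw [min_eq_right h6] at h5
        linarith
      · rw [min_eq_left h6] at h5
        have h7 : (N.routingᵀ *ᵥ δ') k ≤ (N.routingᵀ *ᵥ δ) k :=
          Matrix.mulVec_mono_of_nonneg hN.routing_transpose_nonneg hδle k
        have h8 := hwk k
        have h9 := hδμ k
        have h10 := hδle k
        have h11 : w k ≤ 0 := by
          by_cases hkS : k ∈ S
          · have h12 := hy k
            rw [hyk, NNReal.coe_zero] at h12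
            have h13 : (0 : ℝ) ≤ x k := (x k).2
            nlinarith
          · exact (hwS k hkS).le
        linarith
    obtain ⟨t, ht⟩ := ih _ hcard δ' _ rfl h1' h2' h3' hw' y
      (fun k hk => by simpa using hk) (fun k hk hk0 => absurd hk0 (Finset.mem_filter.1 hk).2)
    refine ⟨τ + t, ?_⟩
    have := hstep.trans ht
    rwa [add_zero] at this

/-- The fluid path: the network empties at no cost. -/
theorem IsAdmissible.exists_reach_zero (hN : N.IsAdmissible) (hsub : N.IsSubcritical)
    (x : Orthant K) : ∃ t, N.Reach c x 0 t 0 := by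
  obtain ⟨δ, h1, h2, h3, h4⟩ := hN.exists_departureRates (Finset.univ.filter fun k => x k ≠ 0)
  obtain ⟨w, hw⟩ : ∃ w : Fin K → ℝ, w = N.arrivalRate + (N.routingᵀ - 1) *ᵥ δ := ⟨_, rfl⟩
  have hwk : ∀ k, w k =
      (N.arrivalRate + N.routingᵀ *ᵥ δ) k - δ k := fun k => by
    rw [hw, Matrix.sub_mulVec, Matrix.one_mulVec]
    simp only [Pi.add_apply, Pi.sub_apply]
    ring
  have h5 : ∀ k, x k = 0 → 0 ≤ w k := fun k hk => by
    rw [hwk]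
    have := (h4 k (by simpa using hk)).le.trans (min_le_right _ _)
    linarith
  -- Initially empty stations whose inflow exceeds capacity are saturated at once and start to fill,
  -- so they join the saturated set.
  refine hN.exists_reach_zero_of_saturated hsub _
    (Finset.univ.filter fun k => x k ≠ 0 ∨ 0 < w k) le_rfl
    δ w hw h1 h2 (fun k hk => ?_) (fun k hk => ?_) x (fun k hk => ?_) (fun k _ => h5 k)
  · rcases (Finset.mem_filter.1 hk).2 with h | h
    · exact h3 k (by simpa using h)
    · by_cases hx : x k = 0
      · rw [hwk] at h
        have h6 := h4 k (by simpa using hx)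
        rcases min_choice (N.serviceRate k) ((N.arrivalRate + N.routingᵀ *ᵥ δ) k) with h7 | h7
        · rw [h6, h7]
        · rw [h7] at h6
          linarith
      · exact h3 k (by simpa using hx)
  · simp only [Finset.mem_filter, Finset.mem_univ, true_and, not_or, not_not, not_lt] at hk
    exact le_antisymm hk.2 (h5 k hk.1)
  · simp only [Finset.mem_filter, Finset.mem_univ, true_and, not_or, not_not, not_lt] at hk
    exact hk.1

end JacksonNetwork

/-! ### Exponentials of rates, least action and the quasipotential -/

/-- The deviability density `exp (-a)` of a rate `a`. -/
noncomputable def expNeg (a : ℝ≥0∞) : ℝ≥0∞ := EReal.exp (-(a : EReal))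

theorem continuous_expNeg : Continuous expNeg :=
  EReal.expHomeomorph.continuous.comp (continuous_neg.comp continuous_coe_ennreal_ereal)

theorem expNeg_le_expNeg {a b : ℝ≥0∞} : expNeg a ≤ expNeg b ↔ b ≤ a := by
  rw [expNeg, expNeg, EReal.exp_le_exp_iff, EReal.neg_le_neg_iff,
    EReal.coe_ennreal_le_coe_ennreal_iff]

theorem antitone_expNeg : Antitone expNeg := fun _ _ h => expNeg_le_expNeg.2 h

theorem expNeg_top : expNeg ⊤ = 0 := by simp [expNeg]

theorem expNeg_zero : expNeg 0 = 1 := by simp [expNeg]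

theorem expNeg_le_one (a : ℝ≥0∞) : expNeg a ≤ 1 := by
  rw [← expNeg_zero]
  exact antitone_expNeg zero_le

theorem expNeg_add (a b : ℝ≥0∞) : expNeg (a + b) = expNeg a * expNeg b := by
  rw [expNeg, EReal.coe_ennreal_add, EReal.neg_add (Or.inl (EReal.coe_ennreal_ne_bot a))
    (Or.inr (EReal.coe_ennreal_ne_bot b)), sub_eq_add_neg, EReal.exp_add]
  rfl

theorem expNeg_iInf {ι : Sort*} (f : ι → ℝ≥0∞) : expNeg (⨅ i, f i) = ⨆ i, expNeg (f i) :=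
  antitone_expNeg.map_iInf_of_continuousAt continuous_expNeg.continuousAt expNeg_top

theorem exists_expNeg_lt {κ : ℝ≥0∞} (hκ : 0 < κ) :
    ∃ M : ℝ, 0 ≤ M ∧ expNeg (ENNReal.ofReal M) < κ := by
  have h1 : Tendsto (fun M : ℝ => expNeg (ENNReal.ofReal M)) atTop (𝓝 0) := by
    have := (continuous_expNeg.tendsto ⊤).comp ENNReal.tendsto_ofReal_atTop
    rwa [expNeg_top] at this
  obtain ⟨M, h2, h3⟩ := ((eventually_ge_atTop (0 : ℝ)).and (h1.eventually (gt_mem_nhds hκ))).exists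
  exact ⟨M, h2, h3⟩

namespace JacksonNetwork

variable {K : ℕ} {N : JacksonNetwork K} {c : ℝ≥0∞}

/-- The least action of a path from `x` to `y` in time `t`. -/
noncomputable def leastAction (N : JacksonNetwork K) (c : ℝ≥0∞) (x : Orthant K) (t : ℝ≥0)
    (y : Orthant K) : ℝ≥0∞ :=
  ⨅ (q : PathSpace K) (_ : q.1 t = y), N.action c x q

theorem transition_singleton (x y : Orthant K) (t : ℝ≥0) :
    N.transition c x t {y} = expNeg (N.leastAction c x t y) := by
  simp only [transition, iSup_singleton, leastAction, expNeg_iInf]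
  rfl

theorem leastAction_le_of_reach (hN : N.IsAdmissible) (hsub : N.IsSubcritical) {x y : Orthant K}
    {t : ℝ≥0} {a : ℝ≥0∞} (h : N.Reach c x y t a) : N.leastAction c x t y ≤ a := by
  obtain ⟨s, hs⟩ := hN.exists_reach_zero (c := c) hsub y
  obtain ⟨q, h1, h2⟩ := h.exists_action_le hN hsub hs
  exact iInf₂_le_of_le q h1 h2

theorem reach_of_leastAction_lt {x y : Orthant K} {t : ℝ≥0} {a : ℝ≥0∞}
    (h : N.leastAction c x t y < a) : N.Reach c x y t a := by
  simp only [leastAction, iInf_lt_iff] at h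
  obtain ⟨q, rfl, h⟩ := h
  exact reach_of_action_lt h

theorem quasipotential_le_leastAction (t : ℝ≥0) (y : Orthant K) :
    N.quasipotential c y ≤ N.leastAction c 0 t y := iInf_le _ t

theorem exists_reach_of_quasipotential_lt {y : Orthant K} {a : ℝ≥0∞}
    (h : N.quasipotential c y < a) : ∃ t, N.Reach c 0 y t a := by
  obtain ⟨t, ht⟩ := iInf_lt_iff.1 h
  exact ⟨t, reach_of_leastAction_lt ht⟩

theorem quasipotential_le_add (hN : N.IsAdmissible) (hsub : N.IsSubcritical)
    {x y : Orthant K} {t : ℝ≥0} {a : ℝ≥0∞} (h : N.Reach c x y t a) :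
    N.quasipotential c y ≤ N.quasipotential c x + a := by
  refine ENNReal.le_of_forall_pos_le_add fun ε hε htop => ?_
  have hx : N.quasipotential c x < ⊤ := lt_of_le_of_lt le_self_add htop
  obtain ⟨s, hs⟩ := exists_reach_of_quasipotential_lt (ENNReal.lt_add_right hx.ne
    (ENNReal.coe_ne_zero.2 hε.ne'))
  refine (quasipotential_le_leastAction _ _).trans
    ((leastAction_le_of_reach hN hsub (hs.trans h)).trans ?_)
  rw [add_right_comm]

theorem quasipotential_zero (hN : N.IsAdmissible) (hsub : N.IsSubcritical) :
    N.quasipotential c 0 = 0 :=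
  nonpos_iff_eq_zero.1 ((quasipotential_le_leastAction 0 0).trans
    (leastAction_le_of_reach hN hsub (reach_refl 0)))

/-- Concatenation gives one inequality. For the other, a nearly optimal path of duration `s` from
the origin is preceded by a free rest of length `t` and then cut at time `s`; exactly `t` remains,
even if `s < t`. -/
theorem quasipotential_eq_iInf (hN : N.IsAdmissible) (hsub : N.IsSubcritical)
    (t : ℝ≥0) (y : Orthant K) :
    N.quasipotential c y = ⨅ x, (N.leastAction c x t y + N.quasipotential c x) := by
  refine le_antisymm (le_iInf fun x => ?_) (le_of_forall_gt fun a ha => ?_)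
  · refine ENNReal.le_of_forall_pos_le_add fun ε hε htop => ?_
    have hx : N.leastAction c x t y < ⊤ := lt_of_le_of_lt le_self_add htop
    refine (quasipotential_le_add hN hsub (reach_of_leastAction_lt (ENNReal.lt_add_right hx.ne
      (ENNReal.coe_ne_zero.2 hε.ne')))).trans ?_
    rw [add_comm, add_right_comm]
  · obtain ⟨a', ha1, ha2⟩ := exists_between ha
    obtain ⟨s, hs⟩ := exists_reach_of_quasipotential_lt ha1
    have h1 := (hN.reach_rest hsub t).trans hs
    rw [zero_add, add_comm] at h1
    obtain ⟨z, a₁, a₂, h2, h3, h4⟩ := h1.split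
    refine lt_of_le_of_lt ?_ ha2
    refine (iInf_le _ z).trans (le_trans ?_ h4)
    rw [add_comm]
    exact add_le_add ((quasipotential_le_leastAction _ _).trans
      (leastAction_le_of_reach hN hsub h2)) (leastAction_le_of_reach hN hsub h3)

/-- Moving along a segment at speed at most one in the sup metric has bounded cost rate on every
face. -/
theorem exists_reach_of_dist_le (hN : N.IsAdmissible) :
    ∃ C : ℝ, 0 < C ∧ ∀ (c : ℝ≥0∞) (x y : Orthant K) (τ : ℝ≥0), 0 < τ → dist x y ≤ τ →
      N.Reach c x y τ (ENNReal.ofReal (C * τ)) := by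
  obtain ⟨C, hC, h⟩ := hN.exists_lagrangian_le
  refine ⟨C, hC, fun c x y τ hτ hxy => ?_⟩
  have hτ' : (0 : ℝ) < τ := hτ
  rw [ENNReal.ofReal_mul hC.le, ENNReal.ofReal_coe_nnreal]
  refine reach_linear x y hτ fun z _ => h c z _ fun k => ?_
  rw [abs_div, abs_of_pos hτ', div_le_one hτ', abs_sub_comm]
  exact (dist_le_pi_dist x y k).trans hxy

theorem quasipotential_ne_top (hN : N.IsAdmissible) (hsub : N.IsSubcritical)
    (y : Orthant K) : N.quasipotential c y ≠ ⊤ := by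
  obtain ⟨C, _, h⟩ := exists_reach_of_dist_le hN
  have h1 := quasipotential_le_add hN hsub (h c 0 y (nndist 0 y + 1) (by positivity) (by simp))
  rw [quasipotential_zero hN hsub, zero_add] at h1
  exact ne_top_of_le_ne_top ENNReal.ofReal_ne_top h1

/-- `V` is finite and Lipschitz, by the triangle inequality applied to segments run at nearly unit
speed. The slack `η` keeps the duration positive when the two points coincide. -/
theorem continuous_quasipotential (hN : N.IsAdmissible) (hsub : N.IsSubcritical) :
    Continuous fun y : Orthant K => N.quasipotential c y := by
  obtain ⟨C, hC, h⟩ := exists_reach_of_dist_le hN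
  have h1 : ∀ x y : Orthant K,
      (N.quasipotential c y).toReal ≤ (N.quasipotential c x).toReal + C * dist y x := by
    intro x y
    refine le_of_forall_pos_le_add fun ε hε => ?_
    have hεC : 0 < ε / C := div_pos hε hC
    obtain ⟨η, hη⟩ : ∃ η : ℝ≥0, (η : ℝ) = ε / C := ⟨⟨_, hεC.le⟩, rfl⟩
    rw [← hη] at hεC
    have h2 := quasipotential_le_add hN hsub (h c x y (nndist x y + η)
      (lt_of_lt_of_le (NNReal.coe_pos.1 hεC) le_add_self) (by simp))
    have h3 := ENNReal.toReal_mono (ENNReal.add_ne_top.2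
      ⟨quasipotential_ne_top hN hsub x, ENNReal.ofReal_ne_top⟩) h2
    rw [ENNReal.toReal_add (quasipotential_ne_top hN hsub x) ENNReal.ofReal_ne_top,
      ENNReal.toReal_ofReal (by positivity)] at h3
    refine h3.trans (le_of_eq ?_)
    push_cast
    rw [dist_comm y x, hη]
    field_simp
    ring
  have h2 : LipschitzWith ⟨C, hC.le⟩ fun y : Orthant K => (N.quasipotential c y).toReal :=
    LipschitzWith.of_le_add_mul _ fun x y => h1 y x
  have h3 : (fun y : Orthant K => N.quasipotential c y) =
      fun y => ENNReal.ofReal (N.quasipotential c y).toReal :=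
    funext fun y => (ENNReal.ofReal_toReal (quasipotential_ne_top hN hsub y)).symm
  rw [h3]
  exact ENNReal.continuous_ofReal.comp h2.continuous

/-! ### Long-time behaviour of the least action -/

namespace IsLyapunov

variable {v : Fin K → ℝ} {b C : ℝ}

theorem exists_content_le (_h : N.IsLyapunov c v b C) {B : Set (Orthant K)}
    (hB : Bornology.IsBounded B) : ∃ R : ℝ, 0 ≤ R ∧ ∀ x ∈ B, content v x ≤ R := by
  have hc : Continuous (content v : Orthant K → ℝ) :=
    continuous_finsetSum _ fun k _ =>
      continuous_const.mul (NNReal.continuous_coe.comp (continuous_apply k))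
  obtain ⟨R, hR⟩ := (hB.isCompact_closure.image hc).bddAbove
  exact ⟨max R 0, le_max_right _ _, fun x hx =>
    (hR (mem_image_of_mem _ (subset_closure hx))).trans (le_max_left _ _)⟩

theorem isBounded_quasipotential_le (h : N.IsLyapunov c v b C) (M : ℝ) :
    Bornology.IsBounded {y : Orthant K | N.quasipotential c y < ENNReal.ofReal M} := by
  refine (Metric.isBounded_closedBall (x := (0 : Orthant K)) (r := C * max M 0)).subset
    fun y hy => ?_
  have h0 : 0 ≤ C * max M 0 := mul_nonneg h.const_pos.le (le_max_right _ _)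
  obtain ⟨t, ht⟩ := exists_reach_of_quasipotential_lt hy
  have h1 := h.content_le (le_max_right M 0) (ht.mono
    (ENNReal.ofReal_le_ofReal (le_max_left _ _)))
  have h2 : content v (0 : Orthant K) = 0 := by simp [content]
  rw [Metric.mem_closedBall, dist_pi_le_iff h0]
  intro k
  have h3 := h.le_content y k
  rw [NNReal.dist_eq, Pi.zero_apply, NNReal.coe_zero, sub_zero, abs_of_nonneg (NNReal.coe_nonneg _)]
  linarith

/-- A path cheaper than `M` has too much time to avoid the origin; its part after the last visit
starts at the origin and costs no more, so `V(y)` is a lower bound. -/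
theorem min_quasipotential_le (hN : N.IsAdmissible) (hsub : N.IsSubcritical)
    (h : N.IsLyapunov c v b C) {x : Orthant K} {M : ℝ} {t : ℝ≥0}
    (ht : content v x + C * M < b * t) (y : Orthant K) :
    min (N.quasipotential c y) (ENNReal.ofReal M) ≤ N.leastAction c x t y := by
  by_contra! hcon
  obtain ⟨a, ha1, ha2⟩ := exists_between hcon
  obtain ⟨ha2, ha3⟩ := lt_min_iff.1 ha2
  have hatop : a ≠ ⊤ := (ha3.trans ENNReal.ofReal_lt_top).ne
  have h1 := reach_of_leastAction_lt ha1
  rw [← ENNReal.ofReal_toReal hatop] at h1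
  have h2 : a.toReal ≤ M := by
    refine ENNReal.toReal_le_of_le_ofReal ?_ ha3.le
    by_contra! hM
    rw [ENNReal.ofReal_of_nonpos hM.le] at ha3
    exact not_lt_zero ha3
  have h3 := mul_le_mul_of_nonneg_left h2 h.const_pos.le
  obtain ⟨t', _, _, h4⟩ := h.exists_last_visit ENNReal.toReal_nonneg h1 (Or.inr (by linarith))
  rw [ENNReal.ofReal_toReal hatop] at h4
  exact ha2.not_ge ((quasipotential_le_leastAction _ _).trans (leastAction_le_of_reach hN hsub h4))

/-- Free drainage from `x` until its first visit to the origin takes at most `content / b`. A nearly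
optimal path to `y`, cut at its last visit, takes at most `C M / b`. The threshold on `t` leaves
room for both, and rest at the origin fills the gap. -/
theorem leastAction_le_quasipotential (hN : N.IsAdmissible) (hsub : N.IsSubcritical)
    (h : N.IsLyapunov c v b C) {x y : Orthant K} {M : ℝ} {t : ℝ≥0}
    (ht : content v x + C * M < b * t) (hy : N.quasipotential c y < ENNReal.ofReal M) :
    N.leastAction c x t y ≤ N.quasipotential c y := by
  refine le_of_forall_gt_imp_ge_of_dense fun a ha => ?_
  have hM : 0 < M := by
    by_contra! hM
    rw [ENNReal.ofReal_of_nonpos hM] at hy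
    exact not_lt_zero hy
  have htop : min a (ENNReal.ofReal M) ≠ ⊤ := ((min_le_right _ _).trans_lt
    ENNReal.ofReal_lt_top).ne
  obtain ⟨s, hs⟩ := exists_reach_of_quasipotential_lt (lt_min ha hy)
  rw [← ENNReal.ofReal_toReal htop] at hs
  obtain ⟨t₂, _, h2, hr2⟩ := h.exists_last_visit ENNReal.toReal_nonneg hs (Or.inl rfl)
  obtain ⟨s₁, hs₁⟩ := hN.exists_reach_zero (c := c) hsub x
  obtain ⟨t₁, h1, hr1⟩ := h.exists_first_visit hs₁
  have h3 : (min a (ENNReal.ofReal M)).toReal ≤ M :=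
    ENNReal.toReal_le_of_le_ofReal hM.le (min_le_right _ _)
  have h4 : t₁ + t₂ ≤ t := by
    rw [← NNReal.coe_le_coe, NNReal.coe_add]
    have := mul_le_mul_of_nonneg_left h3 h.const_pos.le
    refine le_of_mul_le_mul_left ?_ h.pos
    linarith
  have h5 := (hr1.trans (hN.reach_rest hsub (t - (t₁ + t₂)))).trans hr2
  rw [ENNReal.ofReal_toReal htop, zero_add, zero_add, add_right_comm, add_tsub_cancel_of_le h4]
    at h5
  exact leastAction_le_of_reach hN hsub (h5.mono (min_le_left _ _))

theorem eventually_lt (h : N.IsLyapunov c v b C) {B : Set (Orthant K)}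
    (hB : Bornology.IsBounded B) (M : ℝ) :
    ∀ᶠ t : ℝ≥0 in atTop, ∀ x ∈ B, content v x + C * M < b * t := by
  obtain ⟨R, _, hR⟩ := h.exists_content_le hB
  filter_upwards [eventually_gt_atTop ((R + C * M) / b).toNNReal] with t ht x hx
  have h1 : (R + C * M) / b < t := (Real.le_coe_toNNReal _).trans_lt (by exact_mod_cast ht)
  rw [div_lt_iff₀ h.pos] at h1
  linarith [hR x hx]

end IsLyapunov

theorem IsAdmissible.exists_isLyapunov (hN : N.IsAdmissible) (hsub : N.IsSubcritical)
    (c : ℝ≥0∞) : ∃ v b C, N.IsLyapunov c v b C := by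
  obtain ⟨v, b, C, h1, h2, h3, h4⟩ := hN.exists_lyapunov hsub
  exact ⟨v, b, C, h1, h2, h3, h4 c⟩

theorem eventually_transition_eq (hN : N.IsAdmissible) (hsub : N.IsSubcritical)
    {B : Set (Orthant K)} (hB : Bornology.IsBounded B) (y : Orthant K) :
    ∀ᶠ t : ℝ≥0 in atTop, ∀ x ∈ B,
      N.transition c x t {y} = expNeg (N.quasipotential c y) := by
  obtain ⟨v, b, C, hL⟩ := hN.exists_isLyapunov hsub c
  have hy := quasipotential_ne_top (c := c) hN hsub y
  have hlt : N.quasipotential c y < ENNReal.ofReal ((N.quasipotential c y).toReal + 1) := by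
    rw [ENNReal.lt_ofReal_iff_toReal_lt hy]
    exact lt_add_one _
  filter_upwards [hL.eventually_lt hB ((N.quasipotential c y).toReal + 1)] with t ht x hx
  rw [transition_singleton]
  refine congrArg expNeg (le_antisymm (hL.leastAction_le_quasipotential hN hsub (ht x hx) hlt) ?_)
  have := hL.min_quasipotential_le hN hsub (ht x hx) y
  rwa [min_eq_left hlt.le] at this

/-- Where `V(y) < M` the two densities coincide for large `t`. Elsewhere both are at most `exp
(-M)`, which is made smaller than `ε`. -/
theorem tendsto_iSup_transition_sub (hN : N.IsAdmissible) (hsub : N.IsSubcritical)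
    {B : Set (Orthant K)} (hB : Bornology.IsBounded B) :
    Tendsto (fun t : ℝ≥0 => ⨆ x ∈ B, ⨆ y : Orthant K, ENNReal.ofReal
      |(N.transition c x t {y}).toReal - (expNeg (N.quasipotential c y)).toReal|)
      atTop (𝓝 0) := by
  obtain ⟨v, b, C, hL⟩ := hN.exists_isLyapunov hsub c
  rw [ENNReal.tendsto_nhds_zero]
  intro ε hε
  obtain ⟨M, _, hM⟩ := exists_expNeg_lt hε
  filter_upwards [hL.eventually_lt hB M] with t ht
  refine iSup₂_le fun x hx => iSup_le fun y => ?_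
  rw [transition_singleton]
  have h1 := hL.min_quasipotential_le hN hsub (ht x hx) y
  rcases lt_or_ge (N.quasipotential c y) (ENNReal.ofReal M) with hy | hy
  · rw [min_eq_left hy.le] at h1
    rw [le_antisymm (hL.leastAction_le_quasipotential hN hsub (ht x hx) hy) h1]
    simp
  · rw [min_eq_right hy] at h1
    have htop : expNeg (ENNReal.ofReal M) ≠ ⊤ := ne_top_of_le_ne_top ENNReal.one_ne_top
      (expNeg_le_one _)
    have h2 := ENNReal.toReal_mono htop (antitone_expNeg h1)
    have h3 := ENNReal.toReal_mono htop (antitone_expNeg hy)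
    have h4 := ENNReal.toReal_nonneg (a := expNeg (N.leastAction c x t y))
    have h5 := ENNReal.toReal_nonneg (a := expNeg (N.quasipotential c y))
    calc _ ≤ ENNReal.ofReal (expNeg (ENNReal.ofReal M)).toReal :=
          ENNReal.ofReal_le_ofReal (abs_le.2 ⟨by linarith, by linarith⟩)
      _ = expNeg (ENNReal.ofReal M) := ENNReal.ofReal_toReal htop
      _ ≤ ε := hM.le

/-! ### The limit deviability and its uniqueness -/

/-- The deviability whose density is `exp (-V)`, for `V` the quasipotential. -/
noncomputable def limitDeviability (N : JacksonNetwork K) (c : ℝ≥0∞) (G : Set (Orthant K)) :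
    ℝ≥0∞ := ⨆ y ∈ G, expNeg (N.quasipotential c y)

theorem limitDeviability_singleton (y : Orthant K) :
    N.limitDeviability c {y} = expNeg (N.quasipotential c y) := by
  simp [limitDeviability]

theorem isDeviability_limitDeviability (hN : N.IsAdmissible) (hsub : N.IsSubcritical) :
    IsDeviability (N.limitDeviability c) where
  eq_iSup G := by simp only [limitDeviability_singleton]; rfl
  univ_eq_one := by
    refine le_antisymm (iSup₂_le fun y _ => expNeg_le_one _) ?_
    refine le_iSup₂_of_le 0 (mem_univ _) ?_
    rw [quasipotential_zero hN hsub, expNeg_zero]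
  isCompact_level κ hκ _ := by
    obtain ⟨v, b, C, hL⟩ := hN.exists_isLyapunov hsub c
    obtain ⟨M, _, hM⟩ := exists_expNeg_lt hκ
    simp only [limitDeviability_singleton]
    -- Continuity of `V` closes the level set; the content bound on sublevel sets of `V` makes it
    -- bounded.
    refine Metric.isCompact_of_isClosed_isBounded (isClosed_le continuous_const
      (continuous_expNeg.comp (continuous_quasipotential hN hsub)))
      ((hL.isBounded_quasipotential_le M).subset fun y hy => ?_)
    by_contra! hcon
    exact (hM.trans_le hy).not_ge (antitone_expNeg (not_lt.1 hcon))

theorem isStationary_limitDeviability (hN : N.IsAdmissible) (hsub : N.IsSubcritical) :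
    N.IsStationary c (N.limitDeviability c) := fun y t => by
  simp only [limitDeviability_singleton, transition_singleton, ← expNeg_add, ← expNeg_iInf]
  rw [quasipotential_eq_iInf hN hsub t y]

/-- Upper bound: take `κ` strictly between `exp (-V(y))` and a larger `D {y}`. For large `t`, states
in the bounded level set of `κ` contribute at most `exp (-V(y))` to the stationarity supremum and
the others less than `κ`, a contradiction. Lower bound: each `x` gives `exp (-V(y)) D {x} ≤ D {y}`
through a large `t`, and the supremum of `D {x}` is one. -/
theorem eq_limitDeviability (hN : N.IsAdmissible) (hsub : N.IsSubcritical)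
    {D : Set (Orthant K) → ℝ≥0∞} (hD : IsDeviability D) (hst : N.IsStationary c D) :
    D = N.limitDeviability c := by
  have hsup : ⨆ x, D {x} = 1 := by
    rw [← hD.univ_eq_one, hD.eq_iSup univ]
    simp
  have hle : ∀ x, D {x} ≤ 1 := fun x => hsup ▸ le_iSup (fun x => D {x}) x
  have key : ∀ y, D {y} = expNeg (N.quasipotential c y) := by
    intro y
    refine le_antisymm (not_lt.1 fun hlt => ?_) ?_
    · obtain ⟨κ, h1, h2⟩ := exists_between hlt
      have hB := (hD.isCompact_level κ (zero_le.trans_lt h1) (h2.le.trans (hle y))).isBounded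
      obtain ⟨t, ht⟩ := (eventually_transition_eq (c := c) hN hsub hB y).exists
      refine h2.not_ge ((hst y t).le.trans (iSup_le fun x => ?_))
      by_cases hx : κ ≤ D {x}
      · rw [ht x hx]
        exact (mul_le_of_le_one_right zero_le (hle x)).trans h1.le
      · rw [transition_singleton]
        exact (mul_le_of_le_one_left zero_le (expNeg_le_one _)).trans (not_le.1 hx).le
    · rw [← mul_one (expNeg _), ← hsup, ENNReal.mul_iSup]
      refine iSup_le fun x => ?_
      obtain ⟨t, ht⟩ := (eventually_transition_eq (c := c) hN hsub
        (Bornology.isBounded_singleton (x := x)) y).exists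
      rw [← ht x rfl, hst y t]
      exact le_iSup (fun x => N.transition c x t {y} * D {x}) x
  funext G
  rw [hD.eq_iSup G]
  simp only [key]
  rfl

end JacksonNetwork

theorem theorem3 {K : ℕ} (N : JacksonNetwork K) (hN : N.IsAdmissible) (hsub : N.IsSubcritical)
    (c : ℝ≥0∞) (hc : c = 0 ∨ c = ⊤) :
    ∃ D : Set (Orthant K) → ℝ≥0∞,
      IsDeviability D ∧
      (∀ B : Set (Orthant K), Bornology.IsBounded B →
        Tendsto (fun t : ℝ≥0 => ⨆ x ∈ B, ⨆ y : Orthant K,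
          ENNReal.ofReal |(N.transition c x t {y}).toReal - (D {y}).toReal|) atTop (𝓝 0)) ∧
      (∀ B : Set (Orthant K), Bornology.IsBounded B → ∀ y : Orthant K,
        ∀ᶠ t : ℝ≥0 in atTop, ∀ x ∈ B, N.transition c x t {y} = D {y}) ∧
      N.IsStationary c D ∧
      (∀ D' : Set (Orthant K) → ℝ≥0∞, IsDeviability D' → N.IsStationary c D' → D' = D) ∧
      (∀ y : Orthant K, D {y} = EReal.exp (-(N.quasipotential c y : EReal))) := by
  refine ⟨N.limitDeviability c, N.isDeviability_limitDeviability hN hsub, fun B hB => ?_,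
    fun B hB y => ?_, N.isStationary_limitDeviability hN hsub,
    fun D' hD' hst => N.eq_limitDeviability hN hsub hD' hst, N.limitDeviability_singleton⟩
  · simp only [JacksonNetwork.limitDeviability_singleton]
    exact N.tendsto_iSup_transition_sub hN hsub hB
  · simp only [JacksonNetwork.limitDeviability_singleton]
    exact N.eventually_transition_eq hN hsub hB y
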